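/- Let $m>1$. For $\sigma>0$ put $\alpha=\dfrac{\sigma+2}{\sigma(m-1)}$, $\beta=\dfrac1\sigma$, and consider the profile equation $$(f^m)''(\xi)-\alpha f(\xi)+\beta\xi f'(\xi)+\xi^\sigma f(\xi)=0,\qquad \xi\in[0,\infty). \tag{1}$$ A solution of (1) is a continuous function $f:[0,\infty)\to[0,\infty)$ such that $f^m\in C^1([0,\infty))$, equation (1) holds in the classical sense at every point where $f>0$, and the flux $(f^m)'+\beta\xi f$ is differentiable on $[0,\infty)$ with derivative $(\alpha+\beta-\xi^\sigma)f$ (derivatives at $\xi=0$ are one-sided). A solution $f$ is a good profile if either (P1) $f(0)>0$ and $f'(0)=0$, or (P2) $f(0)=0$ and $(f^m)'(0)=0$. A good profile $f$ is a good profile with interface if there are $\xi_1\in(0,\infty)$ and $\delta\in(0,\xi_1]$ with $f(\xi_1)=0$, $(f^m)'(\xi_1)=0$ and $f>0$ on $(\xi_1-\delta,\xi_1)$. **Theorem.** For every $m>1$ and every $\sigma>0$ there exists at least one good profile with interface for (1). Moreover, for $\sigma=\sigma_*:=\sqrt{2(m+1)}$, the function $$f_*(\xi)=\xi^{2/(m-1)}\left(\frac{m-1}{2m(m+1)}-B\xi^{\sigma_*}\right)_+^{1/(m-1)},\qquad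 B=\frac{(m-1)^2}{m(\sigma_*+2)(m\sigma_*+m+1)},$$ is a good profile with interface satisfying (P2). -/

import Mathlib

open Set

/-- The self-similar exponent `α = (σ + 2) / (σ (m - 1))`. -/
noncomputable def alphaExp (m σ : ℝ) : ℝ := (σ + 2) / (σ * (m - 1))

/-- The self-similar exponent `β = 1 / σ`. -/
noncomputable def betaExp (σ : ℝ) : ℝ := 1 / σ

/-- The derivative `(f^m)'` on the half-line `[0, ∞)` (one-sided at `0`). -/
noncomputable def powDeriv (m : ℝ) (f : ℝ → ℝ) (ξ : ℝ) : ℝ :=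
  derivWithin (fun x => f x ^ m) (Ici 0) ξ

/-- `f` is a (nonnegative) profile, that is, a solution of
`(f^m)'' - α f + β ξ f' + ξ^σ f = 0` on `[0, ∞)`.

As usual for a degenerate equation, the solution may vanish, and it need not be differentiable at
its zeros. The equation holds pointwise wherever `f > 0`. Across the zeros of `f` it holds in
conservation form: `f^m` is continuously differentiable and the flux `(f^m)' + β ξ f` is
differentiable with derivative `(α + β - ξ^σ) f`. All derivatives are taken on `[0, ∞)`, so they
are ordinary derivatives at `ξ > 0` and right derivatives at `ξ = 0`. Values of `f` at negative
arguments play no role. -/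
structure IsProfile (m σ : ℝ) (f : ℝ → ℝ) : Prop where
  nonneg : ∀ ξ, 0 ≤ ξ → 0 ≤ f ξ
  continuousOn : ContinuousOn f (Ici 0)
  contDiffOn_pow : ContDiffOn ℝ 1 (fun x => f x ^ m) (Ici 0)
  equation : ∀ ξ, 0 ≤ ξ → 0 < f ξ →
    DifferentiableWithinAt ℝ f (Ici 0) ξ ∧
    DifferentiableWithinAt ℝ (powDeriv m f) (Ici 0) ξ ∧
    derivWithin (powDeriv m f) (Ici 0) ξ - alphaExp m σ * f ξ
      + betaExp σ * ξ * derivWithin f (Ici 0) ξ + ξ ^ σ * f ξ = 0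
  flux : ∀ ξ, 0 ≤ ξ →
    HasDerivWithinAt (fun x => powDeriv m f x + betaExp σ * x * f x)
      ((alphaExp m σ + betaExp σ - ξ ^ σ) * f ξ) (Ici 0) ξ

/-- The initial behavior (P1): `f(0) > 0` and `f'(0) = 0`. -/
def SatisfiesP1 (f : ℝ → ℝ) : Prop :=
  0 < f 0 ∧ HasDerivWithinAt f 0 (Ici 0) 0

/-- The initial behavior (P2): `f(0) = 0` and `(f^m)'(0) = 0`. -/
def SatisfiesP2 (m : ℝ) (f : ℝ → ℝ) : Prop :=
  f 0 = 0 ∧ HasDerivWithinAt (fun x => f x ^ m) 0 (Ici 0) 0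

/-- A good profile: a solution of the profile equation with property (P1) or (P2). -/
def IsGoodProfile (m σ : ℝ) (f : ℝ → ℝ) : Prop :=
  IsProfile m σ f ∧ (SatisfiesP1 f ∨ SatisfiesP2 m f)

/-- `f` has an interface at `ξ₁`: `f(ξ₁) = 0`, `(f^m)'(ξ₁) = 0`, and `f > 0` on a left
neighborhood `(ξ₁ - δ, ξ₁)` contained in the half-line. -/
def HasInterfaceAt (m : ℝ) (f : ℝ → ℝ) (ξ₁ : ℝ) : Prop :=
  f ξ₁ = 0 ∧ HasDerivAt (fun x => f x ^ m) 0 ξ₁ ∧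
    ∃ δ, 0 < δ ∧ δ ≤ ξ₁ ∧ ∀ ξ ∈ Ioo (ξ₁ - δ) ξ₁, 0 < f ξ

/-- A good profile with interface at some point of `(0, ∞)`. -/
def IsGoodProfileWithInterface (m σ : ℝ) (f : ℝ → ℝ) : Prop :=
  IsGoodProfile m σ f ∧ ∃ ξ₁, 0 < ξ₁ ∧ HasInterfaceAt m f ξ₁

/-- The special exponent `σ_* = √(2 (m + 1))`. -/
noncomputable def sigmaStar (m : ℝ) : ℝ := Real.sqrt (2 * (m + 1))

/-- The constant `B = (m - 1)² / (m (σ_* + 2) (m σ_* + m + 1))`. -/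
noncomputable def constB (m : ℝ) : ℝ :=
  (m - 1) ^ 2 / (m * (sigmaStar m + 2) * (m * sigmaStar m + m + 1))

/-- The explicit profile
`f_*(ξ) = ξ^{2/(m-1)} ((m - 1) / (2 m (m + 1)) - B ξ^{σ_*})_+^{1/(m-1)}`. -/
noncomputable def fStar (m : ℝ) (ξ : ℝ) : ℝ :=
  ξ ^ (2 / (m - 1)) *
    (max ((m - 1) / (2 * m * (m + 1)) - constB m * ξ ^ sigmaStar m) 0) ^ (1 / (m - 1))
/-!
Existence is a shooting argument that starts at the interface `R`. In the variable `s = 1 - ξ / R`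
the rescaled power `W ~ f ^ m` and flux `G ~ (f ^ m)' + β ξ f` solve a first order system on
`[0, 1]` with `W 0 = G 0 = 0` and the single parameter `λ = R ^ σ`. A good profile is a nontrivial
solution with `W ≥ 0` and `G 1 = 0`, since the flux at `ξ = 0` is `(f ^ m)'(0)`.

The nonlinearity `W ^ (1 / m)` is not Lipschitz at `0`, which is what allows a nontrivial solution
but prevents continuous dependence on `λ`. It is therefore truncated below at `δ` and above at a
level `N` that solutions do not reach, and `W` starts at `δ`. If `λ ≤ α + β`, then `G` decreases and
`G 1 ≤ 0`. If `λ` is large, then `W` becomes negative while `G` is still bounded below by a positive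
constant; from there on `G` changes too slowly to vanish, so `G 1 > 0`. The intermediate value
theorem gives `G 1 = 0` for some `λ` in a range independent of `δ`. Finally `δ → 0` along a
subsequence, and a lower bound for `W` near `s = 0` that is uniform in `δ` keeps the limit
nontrivial.
-/

open Filter Topology NNReal

section BoundedODE

variable {E : Type*} [NormedAddCommGroup E] [NormedSpace ℝ E] {t₀ t₁ : ℝ}

theorem exists_hasDerivWithinAt_Icc_of_bounded_lipschitz [CompleteSpace E] {v : ℝ → E → E}
    {K M : ℝ≥0} (ht : t₀ ≤ t₁) (hlip : ∀ t ∈ Icc t₀ t₁, LipschitzWith K (v t))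
    (hcont : ∀ x, ContinuousOn (v · x) (Icc t₀ t₁)) (hbdd : ∀ t ∈ Icc t₀ t₁, ∀ x, ‖v t x‖ ≤ M)
    (x₀ : E) :
    ∃ α : ℝ → E, α t₀ = x₀ ∧
      ∀ t ∈ Icc t₀ t₁, HasDerivWithinAt α (v t (α t)) (Icc t₀ t₁) t := by
  have hPL : IsPicardLindelof v (tmin := t₀) (tmax := t₁) ⟨t₀, left_mem_Icc.2 ht⟩ x₀
      (M * (t₁ - t₀).toNNReal) 0 M K :=
    ⟨fun t h => (hlip t h).lipschitzOnWith, fun x _ => hcont x, fun t h x _ => hbdd t h x, by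
      simp [sub_nonneg.2 ht]⟩
  exact hPL.exists_eq_forall_mem_Icc_hasDerivWithinAt₀

theorem continuous_eval_of_hasDerivWithinAt_Icc {P : Type*} [PseudoMetricSpace P]
    {v : P → ℝ → E → E} {x₀ : E} {α : P → ℝ → E} {C : ℝ}
    (hlip : ∀ p, ∃ K, ∀ t ∈ Icc t₀ t₁, LipschitzWith K (v p t))
    (hparam : ∀ p q, ∀ t ∈ Icc t₀ t₁, ∀ x, dist (v q t x) (v p t x) ≤ C * dist q p)
    (hα₀ : ∀ p, α p t₀ = x₀)
    (hα : ∀ p, ∀ t ∈ Icc t₀ t₁, HasDerivWithinAt (α p) (v p t (α p t)) (Icc t₀ t₁) t)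
    {t : ℝ} (ht : t ∈ Icc t₀ t₁) : Continuous (α · t) := by
  have hright : ∀ p, ∀ s ∈ Ico t₀ t₁, HasDerivWithinAt (α p) (v p s (α p s)) (Ici s) s :=
    fun p s hs => (hα p s (Ico_subset_Icc_self hs)).mono_of_mem_nhdsWithin
      (Icc_mem_nhdsGE_of_mem hs)
  have hcont : ∀ p, ContinuousOn (α p) (Icc t₀ t₁) := fun p s hs => (hα p s hs).continuousWithinAt
  refine continuous_iff_continuousAt.2 fun p => tendsto_iff_dist_tendsto_zero.2 ?_
  obtain ⟨K, hK⟩ := hlip p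
  have hgronwall : ∀ q, dist (α q t) (α p t) ≤ gronwallBound 0 K (C * dist q p) (t - t₀) := by
    intro q
    have h := dist_le_of_approx_trajectories_ODE_of_mem (v := v p) (s := fun _ => univ)
      (εf := C * dist q p) (εg := 0) (δ := 0)
      (fun s hs => (hK s (Ico_subset_Icc_self hs)).lipschitzOnWith) (hcont q) (hright q)
      (fun s hs => hparam p q s (Ico_subset_Icc_self hs) _) (fun _ _ => mem_univ _)
      (hcont p) (hright p) (fun s _ => (dist_self _).le) (fun _ _ => mem_univ _)
      (by rw [hα₀, hα₀, dist_self]) t ht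
    rwa [add_zero] at h
  have hε : Tendsto (fun q => C * dist q p) (𝓝 p) (𝓝 0) := by
    simpa using ((continuous_id.dist continuous_const).tendsto' p 0 (dist_self p)).const_mul C
  refine squeeze_zero (fun _ => dist_nonneg) hgronwall ?_
  exact ((gronwallBound_continuous_ε 0 K (t - t₀)).tendsto' 0 0 (gronwallBound_ε0_δ0 _ _)).comp hε

end BoundedODE

/-- A trajectory on `[0, 1]` of the profile equation written in the reversed variable
`s = 1 - ξ / R`, where `R` is the interface: up to constant factors, `W` stands for `f ^ m`, `g W`
for `f`, `G` for the flux `(f ^ m)' + β ξ f` and `lam` for `R ^ σ`, while `a = α + β` and `b = β`.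
The function `g` is `w ↦ w ^ (1 / m)` or a regularization of it. -/
structure IsShot (a b σ lam w₀ : ℝ) (g W G : ℝ → ℝ) : Prop where
  W_zero : W 0 = w₀
  G_zero : G 0 = 0
  hasDerivWithinAt_W : ∀ s ∈ Icc (0 : ℝ) 1,
    HasDerivWithinAt W (b * (1 - s) * g (W s) - G s) (Icc 0 1) s
  hasDerivWithinAt_G : ∀ s ∈ Icc (0 : ℝ) 1,
    HasDerivWithinAt G ((lam * (1 - s) ^ σ - a) * g (W s)) (Icc 0 1) s

section Existence

variable {a b σ lam s : ℝ} {g : ℝ → ℝ}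

theorem one_sub_rpow_mem_Icc (hσ : 0 ≤ σ) (hs : s ∈ Icc (0 : ℝ) 1) :
    (1 - s) ^ σ ∈ Icc (0 : ℝ) 1 :=
  ⟨Real.rpow_nonneg (sub_nonneg.2 hs.2) σ,
    Real.rpow_le_one (sub_nonneg.2 hs.2) (sub_le_self 1 hs.1) hσ⟩

theorem continuous_one_sub_rpow (hσ : 0 ≤ σ) : Continuous fun s : ℝ => (1 - s) ^ σ :=
  (continuous_const.sub continuous_id).rpow_const fun _ => Or.inr hσ

/-- The coefficients of the vector field of `IsShot` in the unknowns `(W + s G, G)`. -/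
noncomputable def shotCoeff (a b σ lam s : ℝ) : ℝ × ℝ :=
  (b * (1 - s) + s * (lam * (1 - s) ^ σ - a), lam * (1 - s) ^ σ - a)

/-- The vector field of `IsShot` in the unknowns `(W + s G, G)`, in which it is bounded as soon as
`g` is. -/
noncomputable def shotField (a b σ : ℝ) (g : ℝ → ℝ) (lam s : ℝ) (x : ℝ × ℝ) : ℝ × ℝ :=
  g (x.1 - s * x.2) • shotCoeff a b σ lam s

theorem continuous_shotCoeff (hσ : 0 ≤ σ) : Continuous (shotCoeff a b σ lam) := by
  have := continuous_one_sub_rpow hσ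
  unfold shotCoeff
  fun_prop

theorem abs_mul_one_sub_rpow_sub_le (hσ : 0 ≤ σ) (hs : s ∈ Icc (0 : ℝ) 1) :
    |lam * (1 - s) ^ σ - a| ≤ |lam| + |a| := by
  have hpow := one_sub_rpow_mem_Icc hσ hs
  refine (abs_sub _ _).trans (add_le_add_left ?_ _)
  rw [abs_mul, abs_of_nonneg hpow.1]
  exact mul_le_of_le_one_right (abs_nonneg _) hpow.2

theorem norm_shotCoeff_le (hσ : 0 ≤ σ) (hs : s ∈ Icc (0 : ℝ) 1) :
    ‖shotCoeff a b σ lam s‖ ≤ |b| + (|lam| + |a|) := by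
  have hsnd := abs_mul_one_sub_rpow_sub_le (a := a) (lam := lam) hσ hs
  refine max_le ?_ (hsnd.trans (le_add_of_nonneg_left (abs_nonneg b)))
  refine (abs_add_le _ _).trans (add_le_add ?_ ?_)
  · rw [abs_mul, abs_of_nonneg (sub_nonneg.2 hs.2)]
    exact mul_le_of_le_one_right (abs_nonneg b) (sub_le_self 1 hs.1)
  · rw [abs_mul, abs_of_nonneg hs.1]
    exact (mul_le_of_le_one_left (abs_nonneg _) hs.2).trans hsnd

theorem norm_shotField_le (hσ : 0 ≤ σ) {B : ℝ} (hB : ∀ w, |g w| ≤ B) (hs : s ∈ Icc (0 : ℝ) 1)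
    (x : ℝ × ℝ) : ‖shotField a b σ g lam s x‖ ≤ B * (|b| + (|lam| + |a|)) := by
  rw [shotField, norm_smul]
  exact mul_le_mul (hB _) (norm_shotCoeff_le hσ hs) (norm_nonneg _) ((abs_nonneg _).trans (hB 0))

theorem lipschitzWith_shotField (hσ : 0 ≤ σ) {K : ℝ≥0} (hg : LipschitzWith K g)
    (hs : s ∈ Icc (0 : ℝ) 1) :
    LipschitzWith (K * 2 * (|b| + (|lam| + |a|)).toNNReal) (shotField a b σ g lam s) := by
  refine LipschitzWith.of_dist_le_mul fun x y => ?_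
  have hproj : dist (x.1 - s * x.2) (y.1 - s * y.2) ≤ 2 * dist x y := by
    have hfst : |x.1 - y.1| ≤ dist x y := le_max_left _ _
    have hsnd : |x.2 - y.2| ≤ dist x y := le_max_right _ _
    calc |x.1 - s * x.2 - (y.1 - s * y.2)| = |(x.1 - y.1) - s * (x.2 - y.2)| := by ring_nf
      _ ≤ |x.1 - y.1| + |s| * |x.2 - y.2| := by rw [← abs_mul]; exact abs_sub _ _
      _ ≤ dist x y + 1 * dist x y := by
        rw [abs_of_nonneg hs.1]
        gcongr
        exact hs.2
      _ = 2 * dist x y := by ring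
  rw [dist_eq_norm, shotField, shotField, ← sub_smul, norm_smul, NNReal.coe_mul, NNReal.coe_mul,
    Real.coe_toNNReal _ (by positivity), mul_right_comm]
  refine mul_le_mul ?_ (norm_shotCoeff_le hσ hs) (norm_nonneg _) (by positivity)
  calc ‖g (x.1 - s * x.2) - g (y.1 - s * y.2)‖ ≤ K * dist (x.1 - s * x.2) (y.1 - s * y.2) :=
        hg.dist_le_mul _ _
    _ ≤ K * (2 * dist x y) := by gcongr
    _ = K * (2 : ℝ≥0) * dist x y := by push_cast; ring

theorem dist_shotField_le (hσ : 0 ≤ σ) {B : ℝ} (hB : ∀ w, |g w| ≤ B) (hs : s ∈ Icc (0 : ℝ) 1)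
    (lam₁ lam₂ : ℝ) (x : ℝ × ℝ) :
    dist (shotField a b σ g lam₁ s x) (shotField a b σ g lam₂ s x) ≤ B * dist lam₁ lam₂ := by
  have hpow := one_sub_rpow_mem_Icc hσ hs
  have hcoeff : shotCoeff a b σ lam₁ s - shotCoeff a b σ lam₂ s =
      ((lam₁ - lam₂) * (1 - s) ^ σ) • ((s, 1) : ℝ × ℝ) := by
    ext <;> simp only [shotCoeff, Prod.fst_sub, Prod.snd_sub, Prod.smul_mk, smul_eq_mul] <;> ring
  have hs1 : ‖((s, 1) : ℝ × ℝ)‖ ≤ 1 :=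
    max_le (by rw [Real.norm_of_nonneg hs.1]; exact hs.2) (by simp)
  rw [dist_eq_norm, shotField, shotField, ← smul_sub, norm_smul, hcoeff, norm_smul, norm_mul,
    Real.norm_of_nonneg hpow.1, dist_eq_norm, mul_assoc ‖lam₁ - lam₂‖]
  refine mul_le_mul (hB _) ?_ (mul_nonneg (norm_nonneg _) (mul_nonneg hpow.1 (norm_nonneg _)))
    ((abs_nonneg _).trans (hB 0))
  exact mul_le_of_le_one_right (norm_nonneg _) (mul_le_one₀ hpow.2 (norm_nonneg _) hs1)

theorem isShot_of_hasDerivWithinAt {w₀ : ℝ} {x : ℝ → ℝ × ℝ} (hx₀ : x 0 = (w₀, 0))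
    (hx : ∀ s ∈ Icc (0 : ℝ) 1,
      HasDerivWithinAt x (shotField a b σ g lam s (x s)) (Icc 0 1) s) :
    IsShot a b σ lam w₀ g (fun s => (x s).1 - s * (x s).2) (fun s => (x s).2) := by
  have hfst : ∀ s ∈ Icc (0 : ℝ) 1, HasDerivWithinAt (fun s => (x s).1)
      (shotField a b σ g lam s (x s)).1 (Icc 0 1) s := fun s hs =>
    (ContinuousLinearMap.fst ℝ ℝ ℝ).hasFDerivAt.comp_hasDerivWithinAt s (hx s hs)
  have hsnd : ∀ s ∈ Icc (0 : ℝ) 1, HasDerivWithinAt (fun s => (x s).2)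
      (shotField a b σ g lam s (x s)).2 (Icc 0 1) s := fun s hs =>
    (ContinuousLinearMap.snd ℝ ℝ ℝ).hasFDerivAt.comp_hasDerivWithinAt s (hx s hs)
  refine ⟨by simp [hx₀], by simp [hx₀], fun s hs => ?_, fun s hs => ?_⟩
  · refine ((hfst s hs).sub ((hasDerivWithinAt_id s _).mul (hsnd s hs))).congr_deriv ?_
    simp only [shotField, shotCoeff, Prod.smul_mk, smul_eq_mul, id]
    ring
  · refine (hsnd s hs).congr_deriv ?_
    simp only [shotField, shotCoeff, Prod.smul_mk, smul_eq_mul]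
    ring

theorem exists_isShot_continuous (a b w₀ : ℝ) (hσ : 0 ≤ σ) {K : ℝ≥0} (hg : LipschitzWith K g)
    {B : ℝ} (hB : ∀ w, |g w| ≤ B) :
    ∃ W G : ℝ → ℝ → ℝ, (∀ lam, IsShot a b σ lam w₀ g (W lam) (G lam)) ∧
      Continuous fun lam => G lam 1 := by
  have hexists : ∀ lam, ∃ x : ℝ → ℝ × ℝ, x 0 = (w₀, 0) ∧ ∀ s ∈ Icc (0 : ℝ) 1,
      HasDerivWithinAt x (shotField a b σ g lam s (x s)) (Icc 0 1) s := fun lam =>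
    exists_hasDerivWithinAt_Icc_of_bounded_lipschitz (M := (B * (|b| + (|lam| + |a|))).toNNReal)
      zero_le_one (fun s hs => lipschitzWith_shotField hσ hg hs)
      (fun x => by
        have := hg.continuous
        have := continuous_shotCoeff (a := a) (b := b) (lam := lam) hσ
        unfold shotField
        exact Continuous.continuousOn (by fun_prop))
      (fun s hs x => (norm_shotField_le hσ hB hs x).trans (Real.le_coe_toNNReal _)) _
  choose x hx₀ hx using hexists
  exact ⟨_, _, fun lam => isShot_of_hasDerivWithinAt (hx₀ lam) (hx lam),
    (continuous_eval_of_hasDerivWithinAt_Icc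
      (fun lam => ⟨_, fun s hs => lipschitzWith_shotField hσ hg hs⟩)
      (fun lam₁ lam₂ s hs => dist_shotField_le hσ hB hs lam₂ lam₁) hx₀ hx
      (right_mem_Icc.2 zero_le_one)).snd⟩

end Existence

/-- The function `w ↦ w ^ θ` with its argument truncated to `[δ, N]`. For `0 < δ` it is bounded and
Lipschitz, and it is bounded below by `δ ^ θ`. -/
noncomputable def truncPow (θ δ N w : ℝ) : ℝ := (max δ (min w N)) ^ θ

section TruncPow

variable {θ δ N w : ℝ}

theorem truncPow_nonneg (hδ : 0 ≤ δ) (w : ℝ) : 0 ≤ truncPow θ δ N w :=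
  Real.rpow_nonneg (hδ.trans (le_max_left _ _)) θ

theorem truncPow_le (hθ : 0 ≤ θ) (hδ : 0 ≤ δ) (hδN : δ ≤ N) (w : ℝ) :
    truncPow θ δ N w ≤ N ^ θ :=
  Real.rpow_le_rpow (hδ.trans (le_max_left _ _)) (max_le hδN (min_le_right _ _)) hθ

theorem abs_truncPow_le (hθ : 0 ≤ θ) (hδ : 0 ≤ δ) (hδN : δ ≤ N) (w : ℝ) :
    |truncPow θ δ N w| ≤ N ^ θ := by
  rw [abs_of_nonneg (truncPow_nonneg hδ w)]
  exact truncPow_le hθ hδ hδN w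

theorem truncPow_of_le (hw : w ≤ δ) : truncPow θ δ N w = δ ^ θ := by
  rw [truncPow, max_eq_left ((min_le_left _ _).trans hw)]

theorem rpow_le_truncPow (hθ : 0 ≤ θ) (hw : 0 ≤ w) (hwN : w ≤ N) : w ^ θ ≤ truncPow θ δ N w := by
  rw [truncPow, min_eq_left hwN]
  exact Real.rpow_le_rpow hw (le_max_right _ _) hθ

theorem truncPow_zero_left (hw : 0 ≤ w) (hwN : w ≤ N) : truncPow θ 0 N w = w ^ θ := by
  rw [truncPow, min_eq_left hwN, max_eq_right hw]

theorem continuous_truncPow (hθ : 0 ≤ θ) :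
    Continuous fun p : ℝ × ℝ => truncPow θ p.1 N p.2 :=
  (continuous_fst.max (continuous_snd.min continuous_const)).rpow_const fun _ => Or.inr hθ

theorem exists_lipschitzWith_truncPow (hδ : 0 < δ) (hδN : δ ≤ N) :
    ∃ K, LipschitzWith K (truncPow θ δ N) := by
  have hpow : ContDiffOn ℝ 1 (fun x : ℝ => x ^ θ) (Icc δ N) := fun x hx =>
    (Real.contDiffAt_rpow_const_of_ne (hδ.trans_le hx.1).ne').contDiffWithinAt
  obtain ⟨K, hK⟩ := hpow.exists_lipschitzOnWith one_ne_zero (convex_Icc δ N) isCompact_Icc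
  have hclamp : LipschitzWith 1 fun w : ℝ => max δ (min w N) :=
    (LipschitzWith.id.min_const N).const_max δ
  exact ⟨_, lipschitzOnWith_univ.1 <| hK.comp hclamp.lipschitzOnWith fun w _ =>
    ⟨le_max_left _ _, max_le hδN (min_le_right _ _)⟩⟩

end TruncPow

section DifferentialInequalities

variable {f f' : ℝ → ℝ} {S : Set ℝ} {x y : ℝ}

theorem monotoneOn_Icc_of_hasDerivWithinAt_nonneg (hS : Icc x y ⊆ S)
    (hf : ∀ s ∈ Icc x y, HasDerivWithinAt f (f' s) S s) (hf' : ∀ s ∈ Icc x y, 0 ≤ f' s) :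
    MonotoneOn f (Icc x y) :=
  monotoneOn_of_hasDerivWithinAt_nonneg (convex_Icc x y)
    (fun s hs => (hf s hs).continuousWithinAt.mono hS)
    (fun s hs => (hf s (interior_subset hs)).mono (interior_subset.trans hS))
    fun s hs => hf' s (interior_subset hs)

theorem antitoneOn_Icc_of_hasDerivWithinAt_nonpos (hS : Icc x y ⊆ S)
    (hf : ∀ s ∈ Icc x y, HasDerivWithinAt f (f' s) S s) (hf' : ∀ s ∈ Icc x y, f' s ≤ 0) :
    AntitoneOn f (Icc x y) :=
  antitoneOn_of_hasDerivWithinAt_nonpos (convex_Icc x y)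
    (fun s hs => (hf s hs).continuousWithinAt.mono hS)
    (fun s hs => (hf s (interior_subset hs)).mono (interior_subset.trans hS))
    fun s hs => hf' s (interior_subset hs)

theorem mul_sub_le_of_le_hasDerivWithinAt (hxy : x ≤ y) (hS : Icc x y ⊆ S)
    (hf : ∀ s ∈ Icc x y, HasDerivWithinAt f (f' s) S s) {C : ℝ} (hC : ∀ s ∈ Icc x y, C ≤ f' s) :
    C * (y - x) ≤ f y - f x := by
  have hmono := monotoneOn_Icc_of_hasDerivWithinAt_nonneg hS
    (fun s hs => (hf s hs).sub ((hasDerivWithinAt_id s S).const_mul C))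
    (fun s hs => by linarith [hC s hs]) (left_mem_Icc.2 hxy) (right_mem_Icc.2 hxy) hxy
  simp only [Pi.sub_apply, id] at hmono
  linarith

theorem sub_le_mul_of_hasDerivWithinAt_le (hxy : x ≤ y) (hS : Icc x y ⊆ S)
    (hf : ∀ s ∈ Icc x y, HasDerivWithinAt f (f' s) S s) {C : ℝ} (hC : ∀ s ∈ Icc x y, f' s ≤ C) :
    f y - f x ≤ C * (y - x) := by
  have h := mul_sub_le_of_le_hasDerivWithinAt hxy hS (fun s hs => (hf s hs).neg)
    (fun s hs => neg_le_neg (hC s hs))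
  simp only [Pi.neg_apply] at h
  linarith

theorem le_exp_mul_of_hasDerivWithinAt_le_mul (hxy : x ≤ y) (hS : Icc x y ⊆ S)
    (hf : ∀ s ∈ Icc x y, HasDerivWithinAt f (f' s) S s) {k : ℝ}
    (hk : ∀ s ∈ Icc x y, f' s ≤ k * f s) : f y ≤ Real.exp (k * (y - x)) * f x := by
  have hexp : ∀ s, HasDerivAt (fun s => Real.exp (-(k * s))) (Real.exp (-(k * s)) * -k) s :=
    fun s => by simpa using (((hasDerivAt_id s).const_mul k).neg).exp
  have hanti := antitoneOn_Icc_of_hasDerivWithinAt_nonpos hS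
    (fun s hs => (hf s hs).mul (hexp s).hasDerivWithinAt)
    (fun s hs => by nlinarith [hk s hs, Real.exp_pos (-(k * s))])
    (left_mem_Icc.2 hxy) (right_mem_Icc.2 hxy) hxy
  simp only [Pi.mul_apply] at hanti
  calc f y = Real.exp (k * y) * (f y * Real.exp (-(k * y))) := by
        rw [mul_left_comm, ← Real.exp_add]; simp
    _ ≤ Real.exp (k * y) * (f x * Real.exp (-(k * x))) := by gcongr
    _ = Real.exp (k * (y - x)) * f x := by
        rw [mul_left_comm, ← Real.exp_add, mul_comm]; ring_nf

theorem rpow_le_of_mul_rpow_le_hasDerivWithinAt (hxy : x ≤ y) (hS : Icc x y ⊆ S)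
    (hf : ∀ s ∈ Icc x y, HasDerivWithinAt f (f' s) S s) (hpos : ∀ s ∈ Icc x y, 0 < f s)
    {θ k : ℝ} (hθ : θ < 1) (hk : 0 ≤ k) (hk' : ∀ s ∈ Icc x y, k * f s ^ θ ≤ f' s) :
    ((1 - θ) * k * (y - x)) ^ (1 / (1 - θ)) ≤ f y := by
  have hθ' : 0 < 1 - θ := sub_pos.2 hθ
  have hx := left_mem_Icc.2 hxy
  have hy := right_mem_Icc.2 hxy
  have hgrowth : (1 - θ) * k * (y - x) ≤ f y ^ (1 - θ) - f x ^ (1 - θ) := by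
    refine mul_sub_le_of_le_hasDerivWithinAt hxy hS
      (fun s hs => (hf s hs).rpow_const (Or.inl (hpos s hs).ne')) fun s hs => ?_
    calc (1 - θ) * k = k * f s ^ θ * (1 - θ) * f s ^ (-θ) := by
          rw [Real.rpow_neg (hpos s hs).le]
          field_simp [(Real.rpow_pos_of_pos (hpos s hs) θ).ne']
      _ ≤ f' s * (1 - θ) * f s ^ (-θ) := by
          have := Real.rpow_nonneg (hpos s hs).le (-θ)
          gcongr
          exact hk' s hs
      _ = f' s * (1 - θ) * f s ^ (1 - θ - 1) := by ring_nf
  calc ((1 - θ) * k * (y - x)) ^ (1 / (1 - θ)) ≤ (f y ^ (1 - θ)) ^ (1 / (1 - θ)) :=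
        Real.rpow_le_rpow (mul_nonneg (mul_nonneg hθ'.le hk) (sub_nonneg.2 hxy))
          (hgrowth.trans (sub_le_self _ (Real.rpow_nonneg (hpos x hx).le _))) (by positivity)
    _ = f y := by
        rw [← Real.rpow_mul (hpos y hy).le, mul_one_div_cancel hθ'.ne', Real.rpow_one]

theorem nonneg_of_hasDerivWithinAt_nonneg_of_nonpos (hxy : x ≤ y) (hS : Icc x y ⊆ S)
    (hf : ∀ s ∈ Icc x y, HasDerivWithinAt f (f' s) S s) (hx : 0 ≤ f x)
    (hf' : ∀ s ∈ Icc x y, f s ≤ 0 → 0 ≤ f' s) : 0 ≤ f y := by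
  suffices hbarrier : ∀ ε > 0, -f y ≤ ε * (y - x) by
    have hlim : Tendsto (fun ε : ℝ => ε * (y - x)) (𝓝[>] 0) (𝓝 0) :=
      ((continuous_mul_const (y - x)).tendsto' 0 0 (zero_mul _)).mono_left nhdsWithin_le_nhds
    exact neg_nonpos.1 (ge_of_tendsto hlim (eventually_mem_nhdsWithin.mono hbarrier))
  intro ε hε
  refine image_le_of_deriv_right_lt_deriv_boundary (f := fun s => -f s) (f' := fun s => -f' s)
    (B := fun s => ε * (s - x)) (B' := fun _ => ε)
    (fun s hs => ((hf s hs).continuousWithinAt.mono hS).neg)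
    (fun s hs => ((hf s (Ico_subset_Icc_self hs)).mono hS).neg.mono_of_mem_nhdsWithin
      (Icc_mem_nhdsGE_of_mem hs)) (by simpa using hx)
    (fun s => by simpa using ((hasDerivAt_id s).sub_const x).const_mul ε) (fun s hs hfs => ?_)
    (right_mem_Icc.2 hxy)
  have hfs' : f s ≤ 0 := neg_nonneg.1 (hfs ▸ mul_nonneg hε.le (sub_nonneg.2 hs.1))
  exact (neg_nonpos.2 (hf' s (Ico_subset_Icc_self hs) hfs')).trans_lt hε

end DifferentialInequalities

theorem hasDerivWithinAt_integral_Icc {E : Type*} [NormedAddCommGroup E] [NormedSpace ℝ E]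
    [CompleteSpace E] {u : ℝ → E} {x y : ℝ} (hu : ContinuousOn u (Icc x y)) {s : ℝ}
    (hs : s ∈ Icc x y) :
    HasDerivWithinAt (fun s => ∫ r in x..s, u r) (u s) (Icc x y) s := by
  have : Fact (s ∈ Icc x y) := ⟨hs⟩
  exact intervalIntegral.integral_hasDerivWithinAt_right
    ((hu.mono (Icc_subset_Icc_right hs.2)).intervalIntegrable_of_Icc hs.1)
    (hu.stronglyMeasurableAtFilter_nhdsWithin measurableSet_Icc s) (hu s hs)

namespace IsShot

section General

variable {a b σ lam w₀ L s : ℝ} {g W G : ℝ → ℝ}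

theorem continuousOn_W (h : IsShot a b σ lam w₀ g W G) : ContinuousOn W (Icc 0 1) :=
  fun s hs => (h.hasDerivWithinAt_W s hs).continuousWithinAt

theorem continuousOn_G (h : IsShot a b σ lam w₀ g W G) : ContinuousOn G (Icc 0 1) :=
  fun s hs => (h.hasDerivWithinAt_G s hs).continuousWithinAt

theorem mul_sub_le_G_sub (h : IsShot a b σ lam w₀ g W G) (ha : 0 ≤ a) (hlam : 0 ≤ lam)
    {B x y : ℝ} (hx : 0 ≤ x) (hxy : x ≤ y) (hy : y ≤ 1)
    (hg : ∀ s ∈ Icc x y, g (W s) ∈ Icc 0 B) : -(a * B) * (y - x) ≤ G y - G x := by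
  have hsub : Icc x y ⊆ Icc (0 : ℝ) 1 := Icc_subset_Icc hx hy
  refine mul_sub_le_of_le_hasDerivWithinAt hxy hsub
    (fun s hs => h.hasDerivWithinAt_G s (hsub hs)) fun s hs => ?_
  have hcoeff : 0 ≤ lam * (1 - s) ^ σ :=
    mul_nonneg hlam (Real.rpow_nonneg (sub_nonneg.2 (hsub hs).2) σ)
  nlinarith [mul_nonneg hcoeff (hg s hs).1, mul_le_mul_of_nonneg_left (hg s hs).2 ha]

theorem G_le (h : IsShot a b σ lam w₀ g W G) (hσ : 0 ≤ σ) (ha : 0 ≤ a) (hlam : 0 ≤ lam)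
    {B : ℝ} (hg : ∀ w, g w ∈ Icc 0 B) (hs : s ∈ Icc (0 : ℝ) 1) : G s ≤ lam * B := by
  have hB : 0 ≤ B := (hg 0).1.trans (hg 0).2
  have hsub : Icc 0 s ⊆ Icc (0 : ℝ) 1 := Icc_subset_Icc_right hs.2
  have hG : G s - G 0 ≤ lam * B * (s - 0) :=
    sub_le_mul_of_hasDerivWithinAt_le hs.1 hsub (fun r hr => h.hasDerivWithinAt_G r (hsub hr))
      fun r hr => mul_le_mul ((sub_le_self _ ha).trans
        (mul_le_of_le_one_right hlam (one_sub_rpow_mem_Icc hσ (hsub hr)).2))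
        (hg _).2 (hg _).1 hlam
  rw [h.G_zero, sub_zero, sub_zero] at hG
  exact hG.trans (mul_le_of_le_one_right (mul_nonneg hlam hB) hs.2)

theorem W_le (h : IsShot a b σ lam w₀ g W G) (ha : 0 ≤ a) (hb : 0 ≤ b) (hlam : 0 ≤ lam)
    {B : ℝ} (hg : ∀ w, g w ∈ Icc 0 B) (hs : s ∈ Icc (0 : ℝ) 1) : W s ≤ w₀ + (a + b) * B := by
  have hB : 0 ≤ B := (hg 0).1.trans (hg 0).2
  have hG : ∀ r ∈ Icc 0 s, -(a * B) ≤ G r := fun r hr => by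
    have := h.mul_sub_le_G_sub ha hlam le_rfl hr.1 (hr.2.trans hs.2) fun q _ => hg (W q)
    rw [h.G_zero] at this
    nlinarith [mul_nonneg ha hB, hr.1, hr.2, hs.2]
  have hsub : Icc 0 s ⊆ Icc (0 : ℝ) 1 := Icc_subset_Icc_right hs.2
  have hW : W s - W 0 ≤ (a + b) * B * (s - 0) :=
    sub_le_mul_of_hasDerivWithinAt_le hs.1 hsub (fun r hr => h.hasDerivWithinAt_W r (hsub hr))
      fun r hr => by
        have : b * (1 - r) * g (W r) ≤ b * 1 * B := by
          have := hr.1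
          have := (hg (W r)).1
          gcongr
          · linarith
          · exact (hg (W r)).2
        linarith [hG r hr]
  rw [h.W_zero] at hW
  nlinarith [mul_nonneg (add_nonneg ha hb) hB, hs.2]

/- The sign of `lam * (1 - s) ^ σ - a` changes at most once, from positive to negative, so `G`
first increases and then decreases. -/
theorem min_le_G (h : IsShot a b σ lam w₀ g W G) (hσ : 0 ≤ σ) (hlam : 0 ≤ lam)
    (hg : ∀ w, 0 ≤ g w) {x y : ℝ} (hx : 0 ≤ x) (hy : y ≤ 1) (hs : s ∈ Icc x y) :
    min (G x) (G y) ≤ G s := by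
  have hpow : ∀ {p q : ℝ}, p ≤ q → q ≤ 1 → lam * (1 - q) ^ σ ≤ lam * (1 - p) ^ σ :=
    fun hpq hq => mul_le_mul_of_nonneg_left
      (Real.rpow_le_rpow (sub_nonneg.2 hq) (sub_le_sub_left hpq 1) hσ) hlam
  rcases le_total a (lam * (1 - s) ^ σ) with hcoeff | hcoeff
  · have hsub : Icc x s ⊆ Icc (0 : ℝ) 1 := Icc_subset_Icc hx (hs.2.trans hy)
    exact (min_le_left _ _).trans <| monotoneOn_Icc_of_hasDerivWithinAt_nonneg hsub
      (fun r hr => h.hasDerivWithinAt_G r (hsub hr))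
      (fun r hr => mul_nonneg (sub_nonneg.2 (hcoeff.trans (hpow hr.2 (hs.2.trans hy)))) (hg _))
      (left_mem_Icc.2 hs.1) (right_mem_Icc.2 hs.1) hs.1
  · have hsub : Icc s y ⊆ Icc (0 : ℝ) 1 := Icc_subset_Icc (hx.trans hs.1) hy
    exact (min_le_right _ _).trans <| antitoneOn_Icc_of_hasDerivWithinAt_nonpos hsub
      (fun r hr => h.hasDerivWithinAt_G r (hsub hr))
      (fun r hr => mul_nonpos_of_nonpos_of_nonneg
        (sub_nonpos.2 ((hpow hr.1 (hr.2.trans hy)).trans hcoeff)) (hg _))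
      (left_mem_Icc.2 hs.2) (right_mem_Icc.2 hs.2) hs.2

theorem G_one_nonpos (h : IsShot a b σ lam w₀ g W G) (hσ : 0 ≤ σ) (hlam : 0 ≤ lam)
    (hlam_le : lam ≤ a) (hg : ∀ w, 0 ≤ g w) : G 1 ≤ 0 := by
  rw [← h.G_zero]
  refine antitoneOn_Icc_of_hasDerivWithinAt_nonpos Subset.rfl h.hasDerivWithinAt_G
    (fun s hs => mul_nonpos_of_nonpos_of_nonneg ?_ (hg _)) (left_mem_Icc.2 zero_le_one)
    (right_mem_Icc.2 zero_le_one) zero_le_one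
  exact sub_nonpos.2
    ((mul_le_of_le_one_right hlam (one_sub_rpow_mem_Icc hσ hs).2).trans hlam_le)

section Mass

theorem hasDerivWithinAt_mass (h : IsShot a b σ lam w₀ g W G) (hg : Continuous g)
    (hs : s ∈ Icc (0 : ℝ) 1) :
    HasDerivWithinAt (fun s => ∫ r in (0 : ℝ)..s, g (W r)) (g (W s)) (Icc 0 1) s :=
  hasDerivWithinAt_integral_Icc (hg.comp_continuousOn h.continuousOn_W) hs

theorem G_le_mul_mass (h : IsShot a b σ lam w₀ g W G) (hσ : 0 ≤ σ) (ha : 0 ≤ a) (hlam : 0 ≤ lam)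
    (hgc : Continuous g) (hg : ∀ w, 0 ≤ g w) (hs : s ∈ Icc (0 : ℝ) 1) :
    G s ≤ lam * ∫ r in (0 : ℝ)..s, g (W r) := by
  have hsub : Icc 0 s ⊆ Icc (0 : ℝ) 1 := Icc_subset_Icc_right hs.2
  have hanti := antitoneOn_Icc_of_hasDerivWithinAt_nonpos hsub
    (fun r hr => (h.hasDerivWithinAt_G r (hsub hr)).sub
      ((h.hasDerivWithinAt_mass hgc (hsub hr)).const_mul lam))
    (fun r hr => by
      have := mul_le_of_le_one_right hlam (one_sub_rpow_mem_Icc hσ (hsub hr)).2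
      nlinarith [hg (W r)])
    (left_mem_Icc.2 hs.1) (right_mem_Icc.2 hs.1) hs.1
  simpa [h.G_zero] using hanti

theorem mul_mass_le_G (h : IsShot a b σ lam w₀ g W G) (hgc : Continuous g) (hg : ∀ w, 0 ≤ g w)
    (hs : s ∈ Icc (0 : ℝ) 1) (hL : ∀ r ∈ Icc 0 s, L ≤ lam * (1 - r) ^ σ - a) :
    L * ∫ r in (0 : ℝ)..s, g (W r) ≤ G s := by
  have hsub : Icc 0 s ⊆ Icc (0 : ℝ) 1 := Icc_subset_Icc_right hs.2
  have hmono := monotoneOn_Icc_of_hasDerivWithinAt_nonneg hsub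
    (fun r hr => (h.hasDerivWithinAt_G r (hsub hr)).sub
      ((h.hasDerivWithinAt_mass hgc (hsub hr)).const_mul L))
    (fun r hr => sub_nonneg.2 (mul_le_mul_of_nonneg_right (hL r hr) (hg _)))
    (left_mem_Icc.2 hs.1) (right_mem_Icc.2 hs.1) hs.1
  simpa [h.G_zero] using hmono

/- Since `G ≤ lam * ∫ g (W)`, the function `W - (b / 4) ∫ g (W) - lam (s - r) ∫ g (W)` of
`r ∈ [0, s]` is nondecreasing. -/
theorem add_mass_le_W (h : IsShot a b σ lam w₀ g W G) (hσ : 0 ≤ σ) (ha : 0 ≤ a) (hb : 0 ≤ b)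
    (hlam : 0 ≤ lam) (hgc : Continuous g) (hg : ∀ w, 0 ≤ g w) (hs : s ∈ Icc (0 : ℝ) (1 / 4))
    (hlams : lam * s ≤ b / 2) : w₀ + b / 4 * ∫ r in (0 : ℝ)..s, g (W r) ≤ W s := by
  have hsub : Icc 0 s ⊆ Icc (0 : ℝ) 1 := Icc_subset_Icc_right (by linarith [hs.2])
  have hmono := monotoneOn_Icc_of_hasDerivWithinAt_nonneg hsub
    (fun r hr => ((h.hasDerivWithinAt_W r (hsub hr)).sub
      ((h.hasDerivWithinAt_mass hgc (hsub hr)).const_mul (b / 4))).sub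
      ((((hasDerivWithinAt_id r _).const_sub s).const_mul lam).mul
        (h.hasDerivWithinAt_mass hgc (hsub hr))))
    (fun r hr => ?_) (left_mem_Icc.2 hs.1) (right_mem_Icc.2 hs.1) hs.1
  · simp only [Pi.sub_apply, Pi.mul_apply, intervalIntegral.integral_same, mul_zero, sub_self,
      sub_zero, zero_mul, h.W_zero, id] at hmono
    linarith
  · have hG := h.G_le_mul_mass hσ ha hlam hgc hg (hsub hr)
    have hcoeff : 0 ≤ b * (1 - r) - b / 4 - lam * (s - r) := by
      nlinarith [hr.1, hr.2, hs.2, mul_nonneg hlam hr.1, mul_nonneg hb (sub_nonneg.2 hr.2)]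
    have := mul_nonneg hcoeff (hg (W r))
    simp only [id]
    linarith

end Mass

theorem monotoneOn_G (h : IsShot a b σ lam w₀ g W G) (hg : ∀ w, 0 ≤ g w) (hs : s ≤ 1)
    (hcoeff : ∀ r ∈ Icc 0 s, 0 ≤ lam * (1 - r) ^ σ - a) : MonotoneOn G (Icc 0 s) :=
  monotoneOn_Icc_of_hasDerivWithinAt_nonneg (Icc_subset_Icc_right hs)
    (fun r hr => h.hasDerivWithinAt_G r (Icc_subset_Icc_right hs hr))
    fun r hr => mul_nonneg (hcoeff r hr) (hg _)

section LargeCoefficient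

variable {t : ℝ}

theorem exists_hasDerivWithinAt_W_sub_G (h : IsShot a b σ lam w₀ g W G) (hb : 0 ≤ b)
    (hg : ∀ w, 0 ≤ g w) (hL : 0 < L) (hs : s ∈ Icc (0 : ℝ) 1)
    (hcoeff : L ≤ lam * (1 - s) ^ σ - a) :
    ∃ q ≤ -G s, HasDerivWithinAt (fun s => W s - b / L * G s) q (Icc 0 1) s := by
  refine ⟨_, ?_, (h.hasDerivWithinAt_W s hs).sub ((h.hasDerivWithinAt_G s hs).const_mul (b / L))⟩
  have hbL : b ≤ b / L * (lam * (1 - s) ^ σ - a) := by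
    rw [div_mul_eq_mul_div, le_div_iff₀ hL]
    exact mul_le_mul_of_nonneg_left hcoeff hb
  nlinarith [mul_le_mul_of_nonneg_right hbL (hg (W s)), mul_nonneg (mul_nonneg hb hs.1) (hg (W s))]

theorem W_sub_G_le (h : IsShot a b σ lam w₀ g W G) (hb : 0 ≤ b) (hg : ∀ w, 0 ≤ g w) (hL : 0 < L)
    (hs : s ∈ Icc 0 t) (ht : t ≤ 1) (hcoeff : ∀ r ∈ Icc 0 t, L ≤ lam * (1 - r) ^ σ - a) :
    W t - b / L * G t ≤ w₀ - (t - s) * G s := by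
  have hsub : Icc 0 t ⊆ Icc (0 : ℝ) 1 := Icc_subset_Icc_right ht
  have hmono := h.monotoneOn_G hg ht fun r hr => hL.le.trans (hcoeff r hr)
  have hzero : (0 : ℝ) ∈ Icc 0 t := ⟨le_rfl, hs.1.trans hs.2⟩
  choose! Q' hQ' hQ using fun r hr =>
    h.exists_hasDerivWithinAt_W_sub_G hb hg hL (hsub hr) (hcoeff r hr)
  have hsubl : Icc 0 s ⊆ Icc 0 t := Icc_subset_Icc_right hs.2
  have hsubr : Icc s t ⊆ Icc 0 t := Icc_subset_Icc_left hs.1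
  have hleft := sub_le_mul_of_hasDerivWithinAt_le (C := 0) hs.1 (hsubl.trans hsub)
    (fun r hr => hQ r (hsubl hr)) fun r hr => (hQ' r (hsubl hr)).trans <| neg_nonpos.2 <|
      h.G_zero.ge.trans (hmono hzero (hsubl hr) hr.1)
  have hright := sub_le_mul_of_hasDerivWithinAt_le (C := -G s) hs.2 (hsubr.trans hsub)
    (fun r hr => hQ r (hsubr hr)) fun r hr => (hQ' r (hsubr hr)).trans <| neg_le_neg <|
      hmono hs (hsubr hr) hr.1
  simp only [h.W_zero, h.G_zero] at hleft
  linarith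

theorem W_sub_G_le_exp_mul (h : IsShot a b σ lam w₀ g W G) (hb : 0 < b) (hg : ∀ w, 0 ≤ g w)
    (hL : 0 < L) (hs : 0 ≤ s) (hst : s ≤ t) (ht : t ≤ 1)
    (hcoeff : ∀ r ∈ Icc s t, L ≤ lam * (1 - r) ^ σ - a) (hW : ∀ r ∈ Icc s t, 0 ≤ W r) :
    W t - b / L * G t ≤ Real.exp (L / b * (t - s)) * (W s - b / L * G s) := by
  have hsub : Icc s t ⊆ Icc 0 1 := Icc_subset_Icc hs ht
  choose! Q' hQ' hQ using fun r hr =>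
    h.exists_hasDerivWithinAt_W_sub_G hb.le hg hL (hsub hr) (hcoeff r hr)
  refine le_exp_mul_of_hasDerivWithinAt_le_mul hst hsub hQ fun r hr => (hQ' r hr).trans ?_
  have hcancel : L / b * (W r - b / L * G r) = L / b * W r - G r := by field_simp
  linarith [mul_nonneg (div_pos hL hb).le (hW r hr)]

/- If `W` stayed nonnegative, `Q = W - (b / L) G` would satisfy `Q' ≤ -G ≤ (L / b) Q` and hence
become exponentially negative, while `-(b / L) G` is not. -/
theorem exists_W_neg (h : IsShot a b σ lam w₀ g W G) (hb : 0 < b) (hg : ∀ w, 0 ≤ g w) (hL : 0 < L)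
    (hcoeff : ∀ r ∈ Icc (0 : ℝ) (1 / 2), L ≤ lam * (1 - r) ^ σ - a) {s₁ γ : ℝ}
    (hs₁ : s₁ ∈ Icc (0 : ℝ) (1 / 8)) (hγG : γ ≤ G s₁) (hw₀ : w₀ ≤ s₁ * γ / 2)
    (hexp : b / L * G (1 / 2) < s₁ * γ / 2 * Real.exp (L / b * (1 / 4))) :
    ∃ s ∈ Icc s₁ (1 / 2), W s < 0 ∧ γ ≤ G s := by
  obtain ⟨hs₁_nonneg, hs₁_le⟩ := hs₁
  have hmono := h.monotoneOn_G hg (by norm_num) fun r hr => hL.le.trans (hcoeff r hr)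
  have hG_half : 0 ≤ G (1 / 2) :=
    h.G_zero.ge.trans (hmono (by norm_num) (by norm_num) (by norm_num))
  have hγ : 0 < s₁ * γ / 2 := pos_of_mul_pos_left
    ((mul_nonneg (div_pos hb hL).le hG_half).trans_lt hexp) (Real.exp_pos _).le
  by_contra! hneg
  have hW : ∀ s ∈ Icc s₁ (1 / 2), 0 ≤ W s := fun s hs => by
    by_contra! hWs
    exact (hneg s hs hWs).not_ge <| hγG.trans <|
      hmono ⟨hs₁_nonneg, by linarith⟩ ⟨hs₁_nonneg.trans hs.1, hs.2⟩ hs.1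
  have hQ : W (2 * s₁) - b / L * G (2 * s₁) ≤ -(s₁ * γ / 2) := by
    have := h.W_sub_G_le hb.le hg hL (s := s₁) (t := 2 * s₁) ⟨hs₁_nonneg, by linarith⟩
      (by linarith) fun r hr => hcoeff r ⟨hr.1, by linarith [hr.2]⟩
    nlinarith [mul_le_mul_of_nonneg_left hγG hs₁_nonneg]
  have hQ_half := h.W_sub_G_le_exp_mul hb hg hL (s := 2 * s₁) (t := 1 / 2) (by linarith)
    (by linarith) (by norm_num) (fun r hr => hcoeff r ⟨by linarith [hr.1], hr.2⟩)
    fun r hr => hW r ⟨by linarith [hr.1], hr.2⟩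
  have hexp_le : Real.exp (L / b * (1 / 4)) ≤ Real.exp (L / b * (1 / 2 - 2 * s₁)) := by
    gcongr
    linarith
  have hW_half := hW (1 / 2) ⟨by linarith, le_rfl⟩
  nlinarith [mul_le_mul_of_nonneg_left hQ (Real.exp_pos (L / b * (1 / 2 - 2 * s₁))).le,
    mul_le_mul_of_nonneg_left hexp_le hγ.le]

end LargeCoefficient

end General

end IsShot

theorem eventually_mul_rpow_lt_mul_exp {c k : ℝ} (hc : 0 < c) (hk : 0 < k) (A p : ℝ) :
    ∀ᶠ x : ℝ in atTop, A * x ^ p < c * Real.exp (k * x) := by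
  filter_upwards [(tendsto_exp_mul_div_rpow_atTop p k hk).eventually_gt_atTop (A / c),
    eventually_gt_atTop 0] with x hx hx0
  rwa [div_lt_div_iff₀ hc (Real.rpow_pos_of_pos hx0 p), mul_comm _ c] at hx

theorem exists_one_add_mul_rpow_le {θ c : ℝ} (hθ : θ ∈ Ico (0 : ℝ) 1) (hc : 0 ≤ c) :
    ∃ N, 1 ≤ N ∧ 1 + c * N ^ θ ≤ N := by
  have hθ' : 0 < 1 - θ := sub_pos.2 hθ.2
  have hc' : 0 < 1 + c := by linarith
  set N := (1 + c) ^ (1 / (1 - θ))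
  have hN : 1 ≤ N := Real.one_le_rpow (by linarith) (by positivity)
  refine ⟨N, hN, ?_⟩
  have hN0 : 0 < N := by linarith
  have hmul : (1 + c) * N ^ θ = N := by
    have hpow : N ^ (1 - θ) = 1 + c := by
      rw [← Real.rpow_mul hc'.le, one_div_mul_cancel hθ'.ne', Real.rpow_one]
    rw [← hpow, ← Real.rpow_add hN0, sub_add_cancel, Real.rpow_one]
  linarith [Real.one_le_rpow hN hθ.1]

/-- A lower bound for `W` near the interface `s = 0` which does not depend on the regularization:
the solution of `Y' = (b / 4) Y ^ θ` with `Y 0 = 0` that is positive for `s > 0`. -/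
noncomputable def interfaceMinorant (θ b s : ℝ) : ℝ := ((1 - θ) * (b / 4) * s) ^ (1 / (1 - θ))

theorem interfaceMinorant_pos {θ b s : ℝ} (hθ : θ < 1) (hb : 0 < b) (hs : 0 < s) :
    0 < interfaceMinorant θ b s :=
  Real.rpow_pos_of_pos (mul_pos (mul_pos (sub_pos.2 hθ) (by positivity)) hs) _

namespace IsShot

theorem G_one_pos {a b σ lam w₀ : ℝ} {g W G : ℝ → ℝ} (h : IsShot a b σ lam w₀ g W G) (hσ : 0 ≤ σ)
    (ha : 0 ≤ a) (hb : 0 ≤ b) (hlam : 0 ≤ lam) (hg : ∀ w, 0 ≤ g w) {c g₀ x : ℝ}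
    (hgc : ∀ w ≤ c, g w = g₀) (hx : x ∈ Icc (0 : ℝ) 1) (hWx : W x ≤ c)
    (hGx : (a + b) * g₀ < G x) : 0 < G 1 := by
  have hg₀ : 0 ≤ g₀ := (hg c).trans_eq (hgc c le_rfl)
  obtain ⟨v, hbv, hva⟩ : ∃ v, b * g₀ < v ∧ v < G x - a * g₀ := exists_between (by linarith)
  by_contra! hG
  obtain ⟨z, hz, rfl⟩ : v ∈ G '' Icc x 1 :=
    intermediate_value_Icc' hx.2 (h.continuousOn_G.mono (Icc_subset_Icc_left hx.1))
      ⟨hG.trans (by nlinarith), by nlinarith⟩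
  have hsub : Icc x z ⊆ Icc 0 1 := Icc_subset_Icc hx.1 hz.2
  have hG_ge : ∀ s ∈ Icc x z, b * g₀ < G s := fun s hs =>
    (lt_min (by nlinarith) hbv).trans_le (h.min_le_G hσ hlam hg hx.1 hz.2 hs)
  have hW_le : ∀ s ∈ Icc x z, W s ≤ c := by
    refine image_le_of_deriv_right_lt_deriv_boundary (B := fun _ => c) (B' := fun _ => 0)
      (h.continuousOn_W.mono hsub)
      (fun s hs => (h.hasDerivWithinAt_W s (hsub (Ico_subset_Icc_self hs))).mono_of_mem_nhdsWithin
        (Icc_mem_nhdsGE_of_mem ⟨hx.1.trans hs.1, hs.2.trans_le hz.2⟩))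
      hWx (fun s => hasDerivAt_const s c) fun s hs hWs => ?_
    rw [hgc _ hWs.le]
    nlinarith [hG_ge s (Ico_subset_Icc_self hs), mul_nonneg (mul_nonneg hb (hx.1.trans hs.1)) hg₀]
  have hG_sub := h.mul_sub_le_G_sub ha hlam hx.1 hz.1 hz.2
    fun s hs => ⟨hg _, (hgc _ (hW_le s hs)).le⟩
  nlinarith [mul_nonneg ha hg₀, hz.2, hx.1]

section TruncPow

variable {a b σ lam θ δ N s : ℝ} {W G : ℝ → ℝ}

theorem W_le_of_truncPow {w₀ : ℝ} (h : IsShot a b σ lam w₀ (truncPow θ δ N) W G) (ha : 0 ≤ a)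
    (hb : 0 ≤ b) (hlam : 0 ≤ lam) (hθ : 0 ≤ θ) (hδ : 0 ≤ δ) (hδN : δ ≤ N) (hw₀ : w₀ ≤ 1)
    (hN : 1 + (a + b) * N ^ θ ≤ N) (hs : s ∈ Icc (0 : ℝ) 1) : W s ≤ N := by
  have := h.W_le ha hb hlam (fun w => ⟨truncPow_nonneg hδ w, truncPow_le hθ hδ hδN w⟩) hs
  linarith

variable (h : IsShot a b σ lam δ (truncPow θ δ N) W G)
include h

theorem interfaceMinorant_le_add_mass (hσ : 0 ≤ σ) (ha : 0 ≤ a) (hb : 0 ≤ b) (hlam : 0 ≤ lam)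
    (hθ : θ ∈ Ico (0 : ℝ) 1) (hδ : 0 < δ) (hδN : δ ≤ N)
    (hWN : ∀ s ∈ Icc (0 : ℝ) 1, W s ≤ N) (hs : s ∈ Icc (0 : ℝ) (1 / 4)) (hlams : lam * s ≤ b / 2) :
    interfaceMinorant θ b s ≤ δ + b / 4 * ∫ r in (0 : ℝ)..s, truncPow θ δ N (W r) := by
  obtain ⟨K, hK⟩ := exists_lipschitzWith_truncPow (θ := θ) hδ hδN
  have hg := truncPow_nonneg (θ := θ) (N := N) hδ.le
  have hsub : Icc 0 s ⊆ Icc (0 : ℝ) 1 := Icc_subset_Icc_right (by linarith [hs.2])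
  have hmass_nonneg : ∀ r ∈ Icc 0 s, 0 ≤ ∫ q in (0 : ℝ)..r, truncPow θ δ N (W q) := fun r hr =>
    intervalIntegral.integral_nonneg hr.1 fun q _ => hg _
  have hY_pos : ∀ r ∈ Icc 0 s, 0 < δ + b / 4 * ∫ q in (0 : ℝ)..r, truncPow θ δ N (W q) :=
    fun r hr => add_pos_of_pos_of_nonneg hδ (mul_nonneg (by positivity) (hmass_nonneg r hr))
  have hY_le : ∀ r ∈ Icc 0 s, δ + b / 4 * ∫ q in (0 : ℝ)..r, truncPow θ δ N (W q) ≤ W r :=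
    fun r hr => h.add_mass_le_W hσ ha hb hlam hK.continuous hg ⟨hr.1, hr.2.trans hs.2⟩
      ((mul_le_mul_of_nonneg_left hr.2 hlam).trans hlams)
  have hY_growth := rpow_le_of_mul_rpow_le_hasDerivWithinAt hs.1 hsub
    (fun r hr => ((h.hasDerivWithinAt_mass hK.continuous (hsub hr)).const_mul (b / 4)).const_add δ)
    hY_pos hθ.2 (k := b / 4) (by positivity) fun r hr => by
      gcongr
      exact (Real.rpow_le_rpow (hY_pos r hr).le (hY_le r hr) hθ.1).trans
        (rpow_le_truncPow hθ.1 ((hY_pos r hr).le.trans (hY_le r hr)) (hWN r (hsub hr)))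
  rwa [sub_zero] at hY_growth

theorem interfaceMinorant_le_W (hσ : 0 ≤ σ) (ha : 0 ≤ a) (hb : 0 ≤ b) (hlam : 0 ≤ lam)
    (hθ : θ ∈ Ico (0 : ℝ) 1) (hδ : 0 < δ) (hδN : δ ≤ N)
    (hWN : ∀ s ∈ Icc (0 : ℝ) 1, W s ≤ N) (hs : s ∈ Icc (0 : ℝ) (1 / 4)) (hlams : lam * s ≤ b / 2) :
    interfaceMinorant θ b s ≤ W s := by
  obtain ⟨K, hK⟩ := exists_lipschitzWith_truncPow (θ := θ) hδ hδN
  exact (h.interfaceMinorant_le_add_mass hσ ha hb hlam hθ hδ hδN hWN hs hlams).trans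
    (h.add_mass_le_W hσ ha hb hlam hK.continuous (truncPow_nonneg hδ.le) hs hlams)

theorem mul_interfaceMinorant_le_G (hσ : 0 ≤ σ) (ha : 0 ≤ a) (hb : 0 < b) (hlam : 0 ≤ lam)
    (hθ : θ ∈ Ico (0 : ℝ) 1) (hδ : 0 < δ) (hδN : δ ≤ N)
    (hWN : ∀ s ∈ Icc (0 : ℝ) 1, W s ≤ N) (hs : s ∈ Icc (0 : ℝ) (1 / 4)) (hlams : lam * s ≤ b / 2)
    {L : ℝ} (hL : 0 ≤ L) (hcoeff : ∀ r ∈ Icc 0 s, L ≤ lam * (1 - r) ^ σ - a)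
    (hδs : δ ≤ interfaceMinorant θ b s / 2) : 2 * L * interfaceMinorant θ b s / b ≤ G s := by
  obtain ⟨K, hK⟩ := exists_lipschitzWith_truncPow (θ := θ) hδ hδN
  have hY := h.interfaceMinorant_le_add_mass hσ ha hb.le hlam hθ hδ hδN hWN hs hlams
  have hmass : 2 * interfaceMinorant θ b s / b ≤ ∫ r in (0 : ℝ)..s, truncPow θ δ N (W r) := by
    rw [div_le_iff₀ hb]
    linarith
  calc 2 * L * interfaceMinorant θ b s / b = L * (2 * interfaceMinorant θ b s / b) := by ring
    _ ≤ L * ∫ r in (0 : ℝ)..s, truncPow θ δ N (W r) := by gcongr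
    _ ≤ G s := h.mul_mass_le_G hK.continuous (truncPow_nonneg hδ.le)
      ⟨hs.1, by linarith [hs.2]⟩ hcoeff

theorem G_one_pos_of_large (hσ : 0 ≤ σ) (ha : 0 ≤ a) (hb : 0 < b) (hlam : 4 * b ≤ lam)
    (hθ : θ ∈ Ico (0 : ℝ) 1) (hδ : 0 < δ) (hδN : δ ≤ N)
    (hWN : ∀ s ∈ Icc (0 : ℝ) 1, W s ≤ N) {L c : ℝ} (hL : 0 < L)
    (hL_le : L ≤ lam * (1 / 2) ^ σ - a) (hc : c = interfaceMinorant θ b (b / (2 * lam)))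
    (hexp : 2 * b * lam ^ 2 * N ^ θ < L ^ 2 * c * Real.exp (L / b * (1 / 4))) (hδc : δ ≤ c / 2)
    (hδL : δ ≤ L * c / (2 * lam)) (hδθ : (a + b) * δ ^ θ < 2 * L * c / b) : 0 < G 1 := by
  have hlam_pos : 0 < lam := by linarith
  have hg := truncPow_nonneg (θ := θ) (N := N) hδ.le
  have hcoeff : ∀ r ∈ Icc (0 : ℝ) (1 / 2), L ≤ lam * (1 - r) ^ σ - a := fun r hr => by
    refine hL_le.trans (sub_le_sub_right ?_ a)
    gcongr
    linarith [hr.2]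
  set s₁ := b / (2 * lam) with hs₁
  have hs₁_nonneg : 0 ≤ s₁ := by positivity
  have hs₁_le : s₁ ≤ 1 / 8 := by
    rw [hs₁, div_le_iff₀ (by positivity)]
    linarith
  have hlams : lam * s₁ = b / 2 := by rw [hs₁]; field_simp
  have hγG : 2 * L * c / b ≤ G s₁ := hc ▸ h.mul_interfaceMinorant_le_G hσ ha hb hlam_pos.le hθ hδ
    hδN hWN ⟨hs₁_nonneg, by linarith⟩ hlams.le hL.le
    (fun r hr => hcoeff r ⟨hr.1, by linarith [hr.2]⟩) (hc ▸ hδc)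
  have hs₁γ : s₁ * (2 * L * c / b) / 2 = L * c / (2 * lam) := by rw [hs₁]; field_simp
  have hG_half : G (1 / 2) ≤ lam * N ^ θ := h.G_le hσ ha hlam_pos.le
    (fun w => ⟨hg w, truncPow_le hθ.1 hδ.le hδN w⟩) (by norm_num)
  obtain ⟨s₂, hs₂, hWs₂, hGs₂⟩ := h.exists_W_neg hb hg hL hcoeff ⟨hs₁_nonneg, hs₁_le⟩ hγG
    (hδL.trans_eq hs₁γ.symm) <| calc
      b / L * G (1 / 2) ≤ b / L * (lam * N ^ θ) := by gcongr
      _ = 2 * b * lam ^ 2 * N ^ θ / (2 * L * lam) := by field_simp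
      _ < L ^ 2 * c * Real.exp (L / b * (1 / 4)) / (2 * L * lam) := by gcongr
      _ = s₁ * (2 * L * c / b) / 2 * Real.exp (L / b * (1 / 4)) := by rw [hs₁γ]; field_simp
  exact h.G_one_pos hσ ha hb.le hlam_pos.le hg (fun w hw => truncPow_of_le hw)
    ⟨hs₁_nonneg.trans hs₂.1, by linarith [hs₂.2]⟩ (hWs₂.le.trans hδ.le) (hδθ.trans_le hGs₂)

end TruncPow

end IsShot

section Approximation

variable {a b σ θ N : ℝ}

theorem exists_lt_interfaceMinorant_mul_exp (a : ℝ) (hb : 0 < b) (hθ : θ < 1) {η : ℝ} (hη : 0 < η)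
    (B : ℝ) :
    ∃ lam, a ≤ lam ∧ 4 * b ≤ lam ∧ a ≤ η * lam ∧ 2 * b * lam ^ 2 * B <
      (η * lam) ^ 2 * interfaceMinorant θ b (b / (2 * lam)) *
        Real.exp (η * lam / b * (1 / 4)) := by
  set p := 1 / (1 - θ)
  set k := (1 - θ) * (b / 4) * (b / 2)
  have hk : 0 < k := mul_pos (mul_pos (sub_pos.2 hθ) (by positivity)) (by positivity)
  have hlarge := eventually_mul_rpow_lt_mul_exp (c := η ^ 2 * k ^ p) (k := η / b * (1 / 4))
    (by positivity) (by positivity) (2 * b * B) p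
  obtain ⟨lam, hexp, ha_le, hb_le, hη_le⟩ := (hlarge.and <| (eventually_ge_atTop a).and <|
    (eventually_ge_atTop (4 * b)).and (eventually_ge_atTop (a / η))).exists
  have hlam : 0 < lam := by linarith
  have hminorant : interfaceMinorant θ b (b / (2 * lam)) * lam ^ p = k ^ p := by
    have hbase : k = (1 - θ) * (b / 4) * (b / (2 * lam)) * lam := by simp only [k]; field_simp
    rw [hbase, Real.mul_rpow (mul_nonneg (mul_nonneg (sub_nonneg.2 hθ.le) (by positivity))
      (by positivity)) hlam.le, interfaceMinorant]
  refine ⟨lam, ha_le, hb_le, by rwa [div_le_iff₀' hη] at hη_le, ?_⟩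
  have hlam_p : 0 < lam ^ p := Real.rpow_pos_of_pos hlam p
  refine lt_of_mul_lt_mul_right ?_ hlam_p.le
  calc 2 * b * lam ^ 2 * B * lam ^ p = lam ^ 2 * (2 * b * B * lam ^ p) := by ring
    _ < lam ^ 2 * (η ^ 2 * k ^ p * Real.exp (η / b * (1 / 4) * lam)) := by gcongr
    _ = _ := by rw [← hminorant]; ring_nf

theorem exists_forall_small_G_one_pos (hσ : 0 ≤ σ) (ha : 0 ≤ a) (hb : 0 < b)
    (hθ : θ ∈ Ioo (0 : ℝ) 1) (hN : 1 ≤ N) (hN' : 1 + (a + b) * N ^ θ ≤ N) :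
    ∃ Λ, a ≤ Λ ∧ 4 * b ≤ Λ ∧ ∀ᶠ δ in 𝓝[>] (0 : ℝ),
      ∀ W G, IsShot a b σ Λ δ (truncPow θ δ N) W G → 0 < G 1 := by
  have hη : (0 : ℝ) < (1 / 2) ^ σ / 2 := by positivity
  obtain ⟨Λ, haΛ, hbΛ, haη, hexp⟩ := exists_lt_interfaceMinorant_mul_exp a hb hθ.2 hη (N ^ θ)
  have hΛ : 0 < Λ := by linarith
  set L := (1 / 2) ^ σ / 2 * Λ with hL
  set c := interfaceMinorant θ b (b / (2 * Λ)) with hc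
  have hc_pos : 0 < c := interfaceMinorant_pos hθ.2 hb (by positivity)
  have hle : ∀ {A : ℝ}, 0 < A → ∀ᶠ δ in 𝓝[>] (0 : ℝ), δ ≤ A := fun hA =>
    nhdsWithin_le_nhds (eventually_le_nhds hA)
  have hδθ : ∀ᶠ δ in 𝓝[>] (0 : ℝ), (a + b) * δ ^ θ < 2 * L * c / b := by
    have : Tendsto (fun δ : ℝ => (a + b) * δ ^ θ) (𝓝 0) (𝓝 0) :=
      ((Real.continuous_rpow_const hθ.1.le).const_mul (a + b)).tendsto' 0 0
        (by rw [Real.zero_rpow hθ.1.ne', mul_zero])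
    exact nhdsWithin_le_nhds (this.eventually_lt_const (by positivity))
  refine ⟨Λ, haΛ, hbΛ, ?_⟩
  filter_upwards [self_mem_nhdsWithin, hle one_pos, hle (half_pos hc_pos),
    hle (show 0 < L * c / (2 * Λ) by positivity), hδθ] with δ hδ hδ1 hδc hδL hδθ W G h
  exact h.G_one_pos_of_large hσ ha hb hbΛ ⟨hθ.1.le, hθ.2⟩ hδ (hδ1.trans hN)
    (fun s hs => h.W_le_of_truncPow ha hb.le hΛ.le hθ.1.le hδ.le (hδ1.trans hN) hδ1 hN' hs)
    (by positivity) (by linarith) hc hexp hδc hδL hδθ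

theorem exists_isShot_G_one_eq_zero (hσ : 0 ≤ σ) (ha : 0 ≤ a) {δ Λ : ℝ} (hθ : 0 ≤ θ) (hδ : 0 < δ)
    (hδN : δ ≤ N) (haΛ : a ≤ Λ)
    (hΛ : ∀ W G, IsShot a b σ Λ δ (truncPow θ δ N) W G → 0 < G 1) :
    ∃ lam ∈ Icc a Λ, ∃ W G, IsShot a b σ lam δ (truncPow θ δ N) W G ∧ G 1 = 0 := by
  obtain ⟨K, hK⟩ := exists_lipschitzWith_truncPow (θ := θ) hδ hδN
  obtain ⟨W, G, h, hcont⟩ := exists_isShot_continuous a b δ hσ hK (abs_truncPow_le hθ hδ.le hδN)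
  obtain ⟨lam, hlam, hG⟩ := intermediate_value_Icc haΛ hcont.continuousOn
    ⟨(h a).G_one_nonpos hσ ha le_rfl (truncPow_nonneg hδ.le), (hΛ _ _ (h Λ)).le⟩
  exact ⟨lam, hlam, W lam, G lam, h lam, hG⟩

end Approximation

section Compactness

theorem exists_subseq_tendsto_of_lipschitzOnWith {X E : Type*} [PseudoMetricSpace X]
    [MetricSpace E] [Nonempty E] {s : Set X} {t : Set E} {K : ℝ≥0} {f : ℕ → X → E}
    (hs : IsCompact s) (ht : IsCompact t) (hf : ∀ n, LipschitzOnWith K (f n) s)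
    (hft : ∀ n, MapsTo (f n) s t) :
    ∃ φ : ℕ → ℕ, StrictMono φ ∧ ∃ g, ContinuousOn g s ∧
      ∀ x ∈ s, Tendsto (fun n => f (φ n) x) atTop (𝓝 (g x)) := by
  have : CompactSpace s := isCompact_iff_compactSpace.1 hs
  have hlip : ∀ n, LipschitzWith K (s.domRestrict (f n)) := fun n => (hf n).to_restrict
  let F : ℕ → BoundedContinuousFunction s E := fun n =>
    BoundedContinuousFunction.mkOfCompact ⟨s.domRestrict (f n), (hlip n).continuous⟩
  have hF : IsCompact (closure (range F)) := by
    refine BoundedContinuousFunction.arzela_ascoli t ht _ ?_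
      (LipschitzWith.uniformEquicontinuous _ K ?_).equicontinuous
    · rintro _ x ⟨n, rfl⟩
      exact hft n x.2
    · rintro ⟨_, n, rfl⟩
      exact hlip n
  obtain ⟨u, -, φ, hφ, hu⟩ := hF.tendsto_subseq fun n => subset_closure (mem_range_self n)
  refine ⟨φ, hφ, Function.extend (↑) u fun _ => Classical.arbitrary E, ?_, fun x hx => ?_⟩
  · rw [continuousOn_iff_continuous_domRestrict]
    exact u.continuous.congr fun x => (Subtype.val_injective.extend_apply _ _ x).symm
  · rw [Subtype.val_injective.extend_apply u _ ⟨x, hx⟩]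
    exact ((continuous_eval_const (⟨x, hx⟩ : s)).tendsto u).comp hu

theorem hasDerivWithinAt_Icc_of_tendsto {E : Type*} [NormedAddCommGroup E] [NormedSpace ℝ E]
    [CompleteSpace E] {u u' : ℕ → ℝ → E} {v v' : ℝ → E} {x y C : ℝ}
    (hu : ∀ n, ∀ s ∈ Icc x y, HasDerivWithinAt (u n) (u' n s) (Icc x y) s)
    (hu' : ∀ n, ContinuousOn (u' n) (Icc x y)) (hC : ∀ n, ∀ s ∈ Icc x y, ‖u' n s‖ ≤ C)
    (hlim : ∀ s ∈ Icc x y, Tendsto (fun n => u n s) atTop (𝓝 (v s)))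
    (hlim' : ∀ s ∈ Icc x y, Tendsto (fun n => u' n s) atTop (𝓝 (v' s)))
    (hv' : ContinuousOn v' (Icc x y)) {s : ℝ} (hs : s ∈ Icc x y) :
    HasDerivWithinAt v (v' s) (Icc x y) s := by
  have hint : ∀ t ∈ Icc x y, v t = v x + ∫ r in x..t, v' r := by
    intro t ht
    have hsub : Icc x t ⊆ Icc x y := Icc_subset_Icc_right ht.2
    have hsub' : uIoc x t ⊆ Icc x y := by
      rw [uIoc_of_le ht.1]
      exact Ioc_subset_Icc_self.trans hsub
    have hlim_int : Tendsto (fun n => ∫ r in x..t, u' n r) atTop (𝓝 (∫ r in x..t, v' r)) :=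
      intervalIntegral.tendsto_integral_filter_of_dominated_convergence (fun _ => C)
        (Eventually.of_forall fun n =>
          ((hu' n).mono hsub').aestronglyMeasurable measurableSet_uIoc)
        (Eventually.of_forall fun n => Eventually.of_forall fun r hr => hC n r (hsub' hr))
        intervalIntegrable_const (Eventually.of_forall fun r hr => hlim' r (hsub' hr))
    have hFTC : ∀ n, ∫ r in x..t, u' n r = u n t - u n x := fun n =>
      intervalIntegral.integral_eq_sub_of_hasDerivAt_of_le ht.1
        (fun r hr => (hu n r (hsub hr)).continuousWithinAt.mono hsub)
        (fun r hr => (hu n r (hsub (Ioo_subset_Icc_self hr))).hasDerivAt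
          (Icc_mem_nhds hr.1 (hr.2.trans_le ht.2)))
        (((hu' n).mono hsub).intervalIntegrable_of_Icc ht.1)
    simp only [hFTC] at hlim_int
    rw [tendsto_nhds_unique hlim_int ((hlim t ht).sub (hlim x ⟨le_rfl, ht.1.trans ht.2⟩)),
      add_sub_cancel]
  exact ((hasDerivWithinAt_integral_Icc hv' hs).const_add _).congr hint (hint s hs)

end Compactness

namespace IsShot

section Limit

variable {a b σ lam w₀ B Λ s : ℝ} {g W G : ℝ → ℝ}

theorem abs_G_coeff_mul_le (hσ : 0 ≤ σ) (hlam : |lam| ≤ Λ) (hg : ∀ w, |g w| ≤ B)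
    (hs : s ∈ Icc (0 : ℝ) 1) (w : ℝ) :
    |(lam * (1 - s) ^ σ - a) * g w| ≤ (Λ + |a|) * B := by
  rw [abs_mul]
  have := (abs_mul_one_sub_rpow_sub_le (a := a) (lam := lam) hσ hs).trans
    (add_le_add_left hlam |a|)
  exact mul_le_mul this (hg w) (abs_nonneg _) ((abs_nonneg _).trans this)

theorem abs_G_le (h : IsShot a b σ lam w₀ g W G) (hσ : 0 ≤ σ) (hlam : |lam| ≤ Λ)
    (hg : ∀ w, |g w| ≤ B) (hs : s ∈ Icc (0 : ℝ) 1) : |G s| ≤ (Λ + |a|) * B := by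
  have hle := (convex_Icc (0 : ℝ) 1).norm_image_sub_le_of_norm_hasDerivWithin_le
    h.hasDerivWithinAt_G (fun r hr => abs_G_coeff_mul_le hσ hlam hg hr (W r))
    (left_mem_Icc.2 zero_le_one) hs
  rw [h.G_zero, sub_zero, sub_zero, Real.norm_of_nonneg hs.1] at hle
  exact hle.trans (mul_le_of_le_one_right ((abs_nonneg _).trans
    (abs_G_coeff_mul_le (a := a) hσ hlam hg hs 0)) hs.2)

theorem abs_deriv_W_le (h : IsShot a b σ lam w₀ g W G) (hσ : 0 ≤ σ) (hlam : |lam| ≤ Λ)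
    (hg : ∀ w, |g w| ≤ B) (hs : s ∈ Icc (0 : ℝ) 1) :
    |b * (1 - s) * g (W s) - G s| ≤ |b| * B + (Λ + |a|) * B := by
  refine (abs_sub _ _).trans (add_le_add ?_ (h.abs_G_le hσ hlam hg hs))
  rw [abs_mul, abs_mul, abs_of_nonneg (sub_nonneg.2 hs.2)]
  exact mul_le_mul (mul_le_of_le_one_right (abs_nonneg b) (sub_le_self 1 hs.1)) (hg _)
    (abs_nonneg _) (abs_nonneg b)

theorem lipschitzOnWith (h : IsShot a b σ lam w₀ g W G) (hσ : 0 ≤ σ) (hlam : |lam| ≤ Λ)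
    (hg : ∀ w, |g w| ≤ B) :
    LipschitzOnWith (|b| * B + (Λ + |a|) * B).toNNReal (fun s => (W s, G s)) (Icc 0 1) := by
  refine (convex_Icc 0 1).lipschitzOnWith_of_nnnorm_hasDerivWithin_le
    (fun s hs => (h.hasDerivWithinAt_W s hs).prodMk (h.hasDerivWithinAt_G s hs)) fun s hs => ?_
  have hB : 0 ≤ B := (abs_nonneg _).trans (hg 0)
  rw [← norm_toNNReal]
  exact Real.toNNReal_le_toNNReal (max_le (h.abs_deriv_W_le hσ hlam hg hs)
    ((abs_G_coeff_mul_le hσ hlam hg hs (W s)).trans (le_add_of_nonneg_left (by positivity))))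

theorem of_tendsto {lams w₀s : ℕ → ℝ} {gs Ws Gs : ℕ → ℝ → ℝ} (hσ : 0 ≤ σ)
    (h : ∀ n, IsShot a b σ (lams n) (w₀s n) (gs n) (Ws n) (Gs n)) (hlams : ∀ n, |lams n| ≤ Λ)
    (hgs : ∀ n, Continuous (gs n)) (hB : ∀ n w, |gs n w| ≤ B)
    (hlam : Tendsto lams atTop (𝓝 lam)) (hw₀ : Tendsto w₀s atTop (𝓝 w₀)) (hg : Continuous g)
    (hgs_lim : ∀ w, Tendsto (fun p : ℕ × ℝ => gs p.1 p.2) (atTop ×ˢ 𝓝 w) (𝓝 (g w)))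
    (hW : ContinuousOn W (Icc 0 1)) (hG : ContinuousOn G (Icc 0 1))
    (hWs : ∀ s ∈ Icc (0 : ℝ) 1, Tendsto (fun n => Ws n s) atTop (𝓝 (W s)))
    (hGs : ∀ s ∈ Icc (0 : ℝ) 1, Tendsto (fun n => Gs n s) atTop (𝓝 (G s))) :
    IsShot a b σ lam w₀ g W G := by
  have hpow := continuous_one_sub_rpow hσ
  have hgW : ∀ s ∈ Icc (0 : ℝ) 1, Tendsto (fun n => gs n (Ws n s)) atTop (𝓝 (g (W s))) :=
    fun s hs => (hgs_lim _).comp (tendsto_id.prodMk (hWs s hs))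
  have hgsWs : ∀ n, ContinuousOn (fun s => gs n (Ws n s)) (Icc 0 1) := fun n =>
    (hgs n).comp_continuousOn (h n).continuousOn_W
  have hgWc : ContinuousOn (fun s => g (W s)) (Icc 0 1) := hg.comp_continuousOn hW
  have hzero : (0 : ℝ) ∈ Icc (0 : ℝ) 1 := left_mem_Icc.2 zero_le_one
  refine ⟨tendsto_nhds_unique (hWs 0 hzero) (by simpa only [(h _).W_zero] using hw₀),
    tendsto_nhds_unique (hGs 0 hzero) (by simp only [(h _).G_zero, tendsto_const_nhds]), ?_, ?_⟩
  · exact fun s hs => hasDerivWithinAt_Icc_of_tendsto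
      (v' := fun s => b * (1 - s) * g (W s) - G s) (fun n => (h n).hasDerivWithinAt_W)
      (fun n => (ContinuousOn.mul (by fun_prop) (hgsWs n)).sub (h n).continuousOn_G)
      (fun n s hs => (h n).abs_deriv_W_le hσ (hlams n) (hB n) hs) hWs
      (fun s hs => ((hgW s hs).const_mul _).sub (hGs s hs))
      ((ContinuousOn.mul (by fun_prop) hgWc).sub hG) hs
  · exact fun s hs => hasDerivWithinAt_Icc_of_tendsto
      (v' := fun s => (lam * (1 - s) ^ σ - a) * g (W s)) (fun n => (h n).hasDerivWithinAt_G)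
      (fun n => ContinuousOn.mul (by fun_prop) (hgsWs n))
      (fun n s hs => abs_G_coeff_mul_le hσ (hlams n) (hB n) hs _) hGs
      (fun s hs => ((hlam.mul_const _).sub_const _).mul (hgW s hs))
      (ContinuousOn.mul (by fun_prop) hgWc) hs

theorem exists_subseq_tendsto {lams w₀s : ℕ → ℝ} {gs Ws Gs : ℕ → ℝ → ℝ} (hσ : 0 ≤ σ)
    (h : ∀ n, IsShot a b σ (lams n) (w₀s n) (gs n) (Ws n) (Gs n)) (hlams : ∀ n, |lams n| ≤ Λ)
    (hgs : ∀ n, Continuous (gs n)) (hB : ∀ n w, |gs n w| ≤ B)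
    (hw₀ : Tendsto w₀s atTop (𝓝 w₀)) (hg : Continuous g)
    (hgs_lim : ∀ w, Tendsto (fun p : ℕ × ℝ => gs p.1 p.2) (atTop ×ˢ 𝓝 w) (𝓝 (g w))) :
    ∃ φ : ℕ → ℕ, StrictMono φ ∧ ∃ lam W G, IsShot a b σ lam w₀ g W G ∧
      Tendsto (fun n => lams (φ n)) atTop (𝓝 lam) ∧
      (∀ s ∈ Icc (0 : ℝ) 1, Tendsto (fun n => Ws (φ n) s) atTop (𝓝 (W s))) ∧
      ∀ s ∈ Icc (0 : ℝ) 1, Tendsto (fun n => Gs (φ n) s) atTop (𝓝 (G s)) := by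
  obtain ⟨w, hw⟩ := Metric.isBounded_iff_subset_closedBall (0 : ℝ) |>.1
    (Metric.isBounded_range_of_tendsto w₀s hw₀)
  set C := |b| * B + (Λ + |a|) * B
  have hball : ∀ n, MapsTo (fun s => (Ws n s, Gs n s)) (Icc (0 : ℝ) 1)
      (Metric.closedBall 0 (w + C.toNNReal)) := by
    intro n s hs
    have hinit : ‖(Ws n 0, Gs n 0)‖ ≤ w := by
      have := hw (mem_range_self n)
      rw [mem_closedBall_zero_iff] at this
      rw [(h n).W_zero, (h n).G_zero]
      exact max_le this (by simpa using (norm_nonneg _).trans this)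
    have hdist := ((h n).lipschitzOnWith hσ (hlams n) (hB n)).dist_le_mul s hs 0
      (left_mem_Icc.2 zero_le_one)
    rw [Real.dist_0_eq_abs, abs_of_nonneg hs.1, dist_eq_norm] at hdist
    rw [mem_closedBall_zero_iff]
    exact (norm_le_norm_add_norm_sub' _ _).trans (add_le_add hinit (hdist.trans
      (mul_le_of_le_one_right (NNReal.coe_nonneg _) hs.2)))
  obtain ⟨lam, -, φ₁, hφ₁, hlam⟩ := (isCompact_closedBall (0 : ℝ) Λ).tendsto_subseq
    fun n => mem_closedBall_zero_iff.2 (hlams n)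
  obtain ⟨φ₂, hφ₂, x, hx, hlim⟩ := exists_subseq_tendsto_of_lipschitzOnWith isCompact_Icc
    (isCompact_closedBall _ _) (fun n => (h (φ₁ n)).lipschitzOnWith hσ (hlams _) (hB _))
    fun n => hball (φ₁ n)
  have hφ : Tendsto (φ₁ ∘ φ₂) atTop atTop := (hφ₁.comp hφ₂).tendsto_atTop
  have hlam' := hlam.comp hφ₂.tendsto_atTop
  have hWs := fun s hs => (hlim s hs).fst_nhds
  have hGs := fun s hs => (hlim s hs).snd_nhds
  exact ⟨φ₁ ∘ φ₂, hφ₁.comp hφ₂, lam, fun s => (x s).1, fun s => (x s).2,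
    of_tendsto hσ (fun n => h (φ₁ (φ₂ n))) (fun n => hlams _) (fun n => hgs _) (fun n => hB _)
      hlam' (hw₀.comp hφ) hg (fun w => (hgs_lim w).comp (hφ.prodMap tendsto_id)) hx.fst hx.snd
      hWs hGs, hlam', hWs, hGs⟩

end Limit

end IsShot

section DegenerateShot

variable {a b σ θ : ℝ}

namespace IsShot

theorem G_nonpos_of_W_nonpos {lam N w₀ s : ℝ} {W G : ℝ → ℝ}
    (h : IsShot a b σ lam w₀ (truncPow θ 0 N) W G) (hσ : 0 ≤ σ) (ha : 0 ≤ a) (hb : 0 ≤ b)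
    (hlam : 0 ≤ lam) (hθ : θ ≠ 0) (hG : G 1 ≤ 0) (hs : s ∈ Icc (0 : ℝ) 1) (hWs : W s ≤ 0) :
    G s ≤ 0 := by
  by_contra! hGs
  refine hG.not_gt (h.G_one_pos hσ ha hb hlam (truncPow_nonneg le_rfl)
    (fun w hw => truncPow_of_le hw) hs hWs ?_)
  rwa [Real.zero_rpow hθ, mul_zero]

theorem W_nonneg {lam N w₀ s : ℝ} {W G : ℝ → ℝ} (h : IsShot a b σ lam w₀ (truncPow θ 0 N) W G)
    (hσ : 0 ≤ σ) (ha : 0 ≤ a) (hb : 0 ≤ b) (hlam : 0 ≤ lam) (hθ : θ ≠ 0) (hw₀ : 0 ≤ w₀)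
    (hG : G 1 ≤ 0) (hs : s ∈ Icc (0 : ℝ) 1) : 0 ≤ W s := by
  have hsub : Icc 0 s ⊆ Icc (0 : ℝ) 1 := Icc_subset_Icc_right hs.2
  refine nonneg_of_hasDerivWithinAt_nonneg_of_nonpos hs.1 hsub
    (fun r hr => h.hasDerivWithinAt_W r (hsub hr)) (hw₀.trans_eq h.W_zero.symm)
    fun r hr hWr => ?_
  have hGr := h.G_nonpos_of_W_nonpos hσ ha hb hlam hθ hG (hsub hr) hWr
  exact sub_nonneg.2 (hGr.trans (mul_nonneg (mul_nonneg hb (sub_nonneg.2 (hsub hr).2))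
    (truncPow_nonneg le_rfl _)))

end IsShot

theorem exists_eventually_isShot_truncPow {N : ℝ} (hσ : 0 ≤ σ) (ha : 0 ≤ a) (hb : 0 < b)
    (hθ : θ ∈ Ioo (0 : ℝ) 1) (hN : 1 ≤ N) (hN' : 1 + (a + b) * N ^ θ ≤ N) :
    ∃ Λ, ∃ s₁ ∈ Ioc (0 : ℝ) 1, ∀ᶠ δ in 𝓝[>] (0 : ℝ), ∃ lam ∈ Icc a Λ, ∃ W G,
      IsShot a b σ lam δ (truncPow θ δ N) W G ∧ G 1 = 0 ∧ (∀ s ∈ Icc (0 : ℝ) 1, W s ≤ N) ∧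
      ∀ s ∈ Ioc 0 s₁, interfaceMinorant θ b s ≤ W s := by
  obtain ⟨Λ, haΛ, hbΛ, hΛ⟩ := exists_forall_small_G_one_pos hσ ha hb hθ hN hN'
  have hΛ_pos : 0 < Λ := by linarith
  have hs₁ : b / (2 * Λ) ≤ 1 / 4 := by
    rw [div_le_iff₀ (by positivity)]
    linarith
  refine ⟨Λ, b / (2 * Λ), ⟨by positivity, by linarith⟩, ?_⟩
  filter_upwards [hΛ, self_mem_nhdsWithin, nhdsWithin_le_nhds (eventually_le_nhds one_pos)]
    with δ hδΛ hδ hδ_le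
  have hδN : δ ≤ N := hδ_le.trans hN
  obtain ⟨lam, hlam, W, G, h, hG⟩ := exists_isShot_G_one_eq_zero hσ ha hθ.1.le hδ hδN haΛ hδΛ
  have hlam_nonneg : 0 ≤ lam := ha.trans hlam.1
  have hWN : ∀ s ∈ Icc (0 : ℝ) 1, W s ≤ N := fun s hs =>
    h.W_le_of_truncPow ha hb.le hlam_nonneg hθ.1.le hδ.le hδN hδ_le hN' hs
  refine ⟨lam, hlam, W, G, h, hG, hWN, fun s hs => ?_⟩
  have hlams : lam * s ≤ b / 2 := calc
    lam * s ≤ Λ * (b / (2 * Λ)) := mul_le_mul hlam.2 hs.2 hs.1.le hΛ_pos.le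
    _ = b / 2 := by field_simp
  exact h.interfaceMinorant_le_W hσ ha hb.le hlam_nonneg ⟨hθ.1.le, hθ.2⟩ hδ hδN hWN
    ⟨hs.1.le, hs.2.trans hs₁⟩ hlams

theorem exists_isShot_truncPow_zero {N : ℝ} (hσ : 0 ≤ σ) (ha : 0 ≤ a) (hb : 0 < b)
    (hθ : θ ∈ Ioo (0 : ℝ) 1) (hN : 1 ≤ N) (hN' : 1 + (a + b) * N ^ θ ≤ N) :
    ∃ lam W G, a ≤ lam ∧ IsShot a b σ lam 0 (truncPow θ 0 N) W G ∧ G 1 = 0 ∧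
      (∀ s ∈ Icc (0 : ℝ) 1, W s ≤ N) ∧ ∃ s₁ ∈ Ioc (0 : ℝ) 1, ∀ s ∈ Ioc 0 s₁, 0 < W s := by
  obtain ⟨Λ, s₁, hs₁, hev⟩ := exists_eventually_isShot_truncPow hσ ha hb hθ hN hN'
  obtain ⟨δ, hδ_lim, hδ⟩ := exists_seq_forall_of_frequently
    ((hev.and (eventually_mem_nhdsWithin.and
      (nhdsWithin_le_nhds (eventually_le_nhds (one_pos.trans_le hN))))).frequently)
  replace hδ_lim : Tendsto δ atTop (𝓝 0) := hδ_lim.mono_right nhdsWithin_le_nhds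
  choose hshot hδ_pos hδN using hδ
  choose lams hlams Ws Gs h hG hWN hW_ge using hshot
  have hpow := continuous_truncPow (N := N) hθ.1.le
  obtain ⟨φ, -, lam, W, G, hlim, hlam, hW, hG_lim⟩ := IsShot.exists_subseq_tendsto hσ h
    (fun n => (abs_of_nonneg (ha.trans (hlams n).1)).trans_le (hlams n).2)
    (fun n => hpow.comp (Continuous.prodMk_right (δ n)))
    (fun n => abs_truncPow_le hθ.1.le (hδ_pos n).le (hδN n)) hδ_lim
    (hpow.comp (Continuous.prodMk_right 0)) fun w =>
      ((hpow.tendsto (0, w)).mono_left nhds_prod_eq.ge).comp (hδ_lim.prodMap tendsto_id)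
  have hG_one : G 1 = 0 := by
    have hone := hG_lim 1 (right_mem_Icc.2 zero_le_one)
    simp only [hG] at hone
    exact tendsto_nhds_unique hone tendsto_const_nhds
  refine ⟨lam, W, G, ge_of_tendsto' hlam fun n => (hlams _).1, hlim, hG_one,
    fun s hs => le_of_tendsto' (hW s hs) fun n => hWN _ s hs, s₁, hs₁, fun s hs => ?_⟩
  exact (interfaceMinorant_pos hθ.2 hb hs.1).trans_le <|
    ge_of_tendsto' (hW s ⟨hs.1.le, hs.2.trans hs₁.2⟩) fun n => hW_ge _ s hs

theorem exists_isShot_rpow (hσ : 0 ≤ σ) (ha : 0 < a) (hb : 0 < b) (hθ : θ ∈ Ioo (0 : ℝ) 1) :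
    ∃ lam W G, 0 < lam ∧ IsShot a b σ lam 0 (fun w => w ^ θ) W G ∧ G 1 = 0 ∧
      (∀ s ∈ Icc (0 : ℝ) 1, 0 ≤ W s) ∧ ∃ s₁ ∈ Ioc (0 : ℝ) 1, ∀ s ∈ Ioc 0 s₁, 0 < W s := by
  obtain ⟨N, hN, hN'⟩ := exists_one_add_mul_rpow_le (θ := θ) ⟨hθ.1.le, hθ.2⟩ (add_pos ha hb).le
  obtain ⟨lam, W, G, hlam, h, hG, hWN, hW_pos⟩ :=
    exists_isShot_truncPow_zero hσ ha.le hb hθ hN hN'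
  have hlam_pos : 0 < lam := ha.trans_le hlam
  have hW_nonneg : ∀ s ∈ Icc (0 : ℝ) 1, 0 ≤ W s := fun s hs =>
    h.W_nonneg hσ ha.le hb.le hlam_pos.le hθ.1.ne' le_rfl hG.le hs
  have hpow : ∀ s ∈ Icc (0 : ℝ) 1, truncPow θ 0 N (W s) = W s ^ θ := fun s hs =>
    truncPow_zero_left (hW_nonneg s hs) (hWN s hs)
  exact ⟨lam, W, G, hlam_pos, ⟨h.W_zero, h.G_zero,
    fun s hs => hpow s hs ▸ h.hasDerivWithinAt_W s hs,
    fun s hs => hpow s hs ▸ h.hasDerivWithinAt_G s hs⟩, hG, hW_nonneg, hW_pos⟩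

end DegenerateShot

/-- The profile equation as a first order system for `f` and its flux `F = (f ^ m)' + β ξ f`:
`(f ^ m)' = F - β ξ f` and `F' = (α + β - ξ ^ σ) f` on `[0, ∞)`, with `f` nonnegative. -/
structure IsFluxPair (m σ : ℝ) (f F : ℝ → ℝ) : Prop where
  nonneg : ∀ x, 0 ≤ x → 0 ≤ f x
  hasDerivWithinAt_pow : ∀ x, 0 ≤ x →
    HasDerivWithinAt (fun x => f x ^ m) (F x - betaExp σ * x * f x) (Ici 0) x
  hasDerivWithinAt_flux : ∀ x, 0 ≤ x →
    HasDerivWithinAt F ((alphaExp m σ + betaExp σ - x ^ σ) * f x) (Ici 0) x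

namespace IsFluxPair

variable {m σ x R : ℝ} {f F : ℝ → ℝ}

theorem eqOn_pow_rpow_inv (h : IsFluxPair m σ f F) (hm : m ≠ 0) :
    EqOn f (fun x => (f x ^ m) ^ m⁻¹) (Ici 0) :=
  fun x hx => (Real.rpow_rpow_inv (h.nonneg x hx) hm).symm

theorem continuousOn (h : IsFluxPair m σ f F) (hm : 0 < m) : ContinuousOn f (Ici 0) :=
  ContinuousOn.congr (fun x hx => (h.hasDerivWithinAt_pow x hx).continuousWithinAt.rpow_const
    (Or.inr (inv_pos.2 hm).le)) (h.eqOn_pow_rpow_inv hm.ne')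

theorem hasDerivWithinAt_of_pos (h : IsFluxPair m σ f F) (hm : m ≠ 0) (hx : 0 ≤ x)
    (hfx : 0 < f x) :
    HasDerivWithinAt f ((F x - betaExp σ * x * f x) * m⁻¹ * (f x ^ m) ^ (m⁻¹ - 1)) (Ici 0) x :=
  ((h.hasDerivWithinAt_pow x hx).rpow_const (Or.inl (Real.rpow_pos_of_pos hfx m).ne')).congr
    (h.eqOn_pow_rpow_inv hm) (h.eqOn_pow_rpow_inv hm hx)

theorem powDeriv_eq (h : IsFluxPair m σ f F) (hx : 0 ≤ x) :
    powDeriv m f x = F x - betaExp σ * x * f x :=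
  (h.hasDerivWithinAt_pow x hx).derivWithin (uniqueDiffOn_Ici 0 x hx)

theorem hasDerivWithinAt_powDeriv_of_pos (h : IsFluxPair m σ f F) (hm : m ≠ 0) (hx : 0 ≤ x)
    (hfx : 0 < f x) :
    HasDerivWithinAt (powDeriv m f)
      (alphaExp m σ * f x - betaExp σ * x * derivWithin f (Ici 0) x - x ^ σ * f x) (Ici 0) x := by
  have hf := (h.hasDerivWithinAt_of_pos hm hx hfx).differentiableWithinAt.hasDerivWithinAt
  refine (((h.hasDerivWithinAt_flux x hx).sub
    (((hasDerivWithinAt_id x (Ici 0)).const_mul (betaExp σ)).mul hf)).congr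
      (fun y hy => h.powDeriv_eq hy) (h.powDeriv_eq hx)).congr_deriv ?_
  simp only [id]
  ring

theorem isProfile (h : IsFluxPair m σ f F) (hm : 0 < m) : IsProfile m σ f where
  nonneg := h.nonneg
  continuousOn := h.continuousOn hm
  contDiffOn_pow := by
    rw [contDiffOn_one_iff_derivWithin (uniqueDiffOn_Ici 0)]
    have hF : ContinuousOn F (Ici 0) := fun x hx =>
      (h.hasDerivWithinAt_flux x hx).continuousWithinAt
    exact ⟨fun x hx => (h.hasDerivWithinAt_pow x hx).differentiableWithinAt,
      (hF.sub (ContinuousOn.mul (by fun_prop) (h.continuousOn hm))).congr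
        fun x hx => h.powDeriv_eq hx⟩
  equation x hx hfx := by
    have hpow := h.hasDerivWithinAt_powDeriv_of_pos hm.ne' hx hfx
    refine ⟨(h.hasDerivWithinAt_of_pos hm.ne' hx hfx).differentiableWithinAt,
      hpow.differentiableWithinAt, ?_⟩
    rw [hpow.derivWithin (uniqueDiffOn_Ici 0 x hx)]
    ring
  flux x hx := by
    have hflux : EqOn (fun x => powDeriv m f x + betaExp σ * x * f x) F (Ici 0) := fun y hy => by
      simp only [h.powDeriv_eq hy, sub_add_cancel]
    exact (h.hasDerivWithinAt_flux x hx).congr hflux (hflux hx)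

theorem satisfiesP1 (h : IsFluxPair m σ f F) (hm : m ≠ 0) (hF : F 0 = 0) (hf : 0 < f 0) :
    SatisfiesP1 f :=
  ⟨hf, by simpa [hF] using h.hasDerivWithinAt_of_pos hm le_rfl hf⟩

theorem satisfiesP2 (h : IsFluxPair m σ f F) (hF : F 0 = 0) (hf : f 0 = 0) : SatisfiesP2 m f :=
  ⟨hf, by simpa [hF] using h.hasDerivWithinAt_pow 0 le_rfl⟩

theorem isGoodProfile (h : IsFluxPair m σ f F) (hm : 0 < m) (hF : F 0 = 0) :
    IsGoodProfile m σ f :=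
  ⟨h.isProfile hm, (h.nonneg 0 le_rfl).eq_or_lt'.symm.imp (h.satisfiesP1 hm.ne' hF)
    (h.satisfiesP2 hF)⟩

theorem hasInterfaceAt (h : IsFluxPair m σ f F) (hR : 0 < R) (hf : f R = 0) (hF : F R = 0)
    (hpos : ∃ δ, 0 < δ ∧ δ ≤ R ∧ ∀ x ∈ Ioo (R - δ) R, 0 < f x) : HasInterfaceAt m f R :=
  ⟨hf, by simpa [hf, hF] using (h.hasDerivWithinAt_pow R hR.le).hasDerivAt (Ici_mem_nhds hR), hpos⟩

end IsFluxPair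

section ProfileOfShot

theorem hasDerivWithinAt_comp_max_zero {u u' : ℝ → ℝ} {t : Set ℝ} {s : ℝ}
    (hu : 0 ≤ s → HasDerivWithinAt u (u' s) (Ici 0 ∩ t) s) (hu' : u' 0 = 0) :
    HasDerivWithinAt (fun s => u (max s 0)) (u' (max s 0)) t s := by
  have hright : 0 ≤ s → HasDerivWithinAt (fun s => u (max s 0)) (u' s) (Ici 0 ∩ t) s := fun hs =>
    (hu hs).congr (fun y hy => by rw [max_eq_left hy.1]) (by rw [max_eq_left hs])
  have hleft : s ≤ 0 → HasDerivWithinAt (fun s => u (max s 0)) 0 (Iic 0) s := fun hs =>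
    (hasDerivWithinAt_const s (Iic 0) (u 0)).congr (fun y hy => by rw [max_eq_right hy])
      (by rw [max_eq_right hs])
  rcases lt_trichotomy s 0 with hs | rfl | hs
  · rw [max_eq_right hs.le, hu']
    exact ((hleft hs.le).hasDerivAt (Iic_mem_nhds hs)).hasDerivWithinAt
  · rw [max_self]
    exact (((hleft le_rfl).congr_deriv hu'.symm).union (hright le_rfl)).mono fun y hy =>
      (le_total y 0).imp id fun hy0 => ⟨hy0, hy⟩
  · rw [max_eq_left hs.le]
    exact (hright hs.le).mono_of_mem_nhdsWithin
      (inter_mem (mem_nhdsWithin_of_mem_nhds (Ici_mem_nhds hs)) self_mem_nhdsWithin)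

theorem hasDerivWithinAt_comp_one_sub_div_max {u u' : ℝ → ℝ} {R x : ℝ} (hR : 0 ≤ R)
    (hu : ∀ s ∈ Icc (0 : ℝ) 1, HasDerivWithinAt u (u' s) (Icc 0 1) s) (hu' : u' 0 = 0)
    (hx : 0 ≤ x) :
    HasDerivWithinAt (fun x => u (max (1 - x / R) 0)) (u' (max (1 - x / R) 0) * -(1 / R))
      (Ici 0) x := by
  have hmaps : MapsTo (fun x : ℝ => 1 - x / R) (Ici 0) (Iic 1) := fun y hy =>
    sub_le_self 1 (div_nonneg hy hR)
  have hinner : HasDerivWithinAt (fun x : ℝ => 1 - x / R) (-(1 / R)) (Ici 0) x :=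
    (((hasDerivAt_id x).div_const R).const_sub 1).hasDerivWithinAt
  have houter := hasDerivWithinAt_comp_max_zero (t := Iic 1)
    (fun hs => hu (1 - x / R) ⟨hs, hmaps hx⟩) hu'
  exact HasDerivWithinAt.comp (h₂ := fun s => u (max s 0)) x houter hinner hmaps

/-- The function on `[0, ∞)` obtained from the first component of a shot with exponent `θ = 1 / m`
by undoing the substitution `s = 1 - ξ / R` and `f ^ m = c ^ m W`, extended by zero beyond `R`. -/
noncomputable def shotProfile (m c R : ℝ) (W : ℝ → ℝ) (x : ℝ) : ℝ :=
  c * W (max (1 - x / R) 0) ^ m⁻¹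

variable {m σ lam c R : ℝ} {W G : ℝ → ℝ}

theorem shotProfile_rpow (hm : m ≠ 0) (hc : 0 ≤ c) {x : ℝ} (hW : 0 ≤ W (max (1 - x / R) 0)) :
    shotProfile m c R W x ^ m = c ^ m * W (max (1 - x / R) 0) := by
  rw [shotProfile, Real.mul_rpow hc (Real.rpow_nonneg hW _), Real.rpow_inv_rpow hW hm]

/- The relations `R ^ σ = lam` and `c ^ m = c * R ^ 2` make the profile equation scale to the
system satisfied by a shot. -/
theorem IsShot.isFluxPair
    (h : IsShot (alphaExp m σ + betaExp σ) (betaExp σ) σ lam 0 (fun w => w ^ m⁻¹) W G)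
    (hm : 0 < m) (hc : 0 ≤ c) (hR : 0 < R) (hRσ : R ^ σ = lam) (hcR : c ^ m = c * R ^ 2)
    (hW : ∀ s ∈ Icc (0 : ℝ) 1, 0 ≤ W s) :
    IsFluxPair m σ (shotProfile m c R W) (fun x => c * R * G (max (1 - x / R) 0)) := by
  have hzero : (0 : ℝ) ^ m⁻¹ = 0 := Real.zero_rpow (inv_ne_zero hm.ne')
  have hW_nonneg : ∀ x, 0 ≤ x → 0 ≤ W (max (1 - x / R) 0) := fun x hx =>
    hW _ ⟨le_max_right _ _, max_le (sub_le_self 1 (div_nonneg hx hR.le)) zero_le_one⟩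
  have hcases : ∀ x, max (1 - x / R) 0 = 1 - x / R ∨ W (max (1 - x / R) 0) ^ m⁻¹ = 0 := fun x => by
    rcases max_choice (1 - x / R) 0 with hmax | hmax
    · exact Or.inl hmax
    · exact Or.inr (by rw [hmax, h.W_zero, hzero])
  refine ⟨fun x hx => mul_nonneg hc (Real.rpow_nonneg (hW_nonneg x hx) _), fun x hx => ?_,
    fun x hx => ?_⟩
  · refine (((hasDerivWithinAt_comp_one_sub_div_max hR.le h.hasDerivWithinAt_W
      (by simp [h.W_zero, h.G_zero, hzero]) hx).const_mul (c ^ m)).congr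
        (fun y hy => shotProfile_rpow hm.ne' hc (hW_nonneg y hy))
        (shotProfile_rpow hm.ne' hc (hW_nonneg x hx))).congr_deriv ?_
    rw [hcR, shotProfile]
    rcases hcases x with hmax | hpow
    · rw [hmax]
      field_simp
      ring
    · rw [hpow]
      field_simp
      ring
  · refine ((hasDerivWithinAt_comp_one_sub_div_max hR.le h.hasDerivWithinAt_G
      (by simp [h.W_zero, hzero]) hx).const_mul (c * R)).congr_deriv ?_
    rw [shotProfile]
    rcases hcases x with hmax | hpow
    · have hlam : lam * (x / R) ^ σ = x ^ σ := by
        rw [Real.div_rpow hx hR.le, hRσ, mul_div_cancel₀]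
        exact hRσ ▸ (Real.rpow_pos_of_pos hR σ).ne'
      rw [hmax, sub_sub_cancel, hlam]
      field_simp
      ring
    · simp only [hpow, mul_zero, zero_mul]

theorem exists_isGoodProfileWithInterface (hm : 1 < m) (hσ : 0 < σ) :
    ∃ f : ℝ → ℝ, IsGoodProfileWithInterface m σ f := by
  have hm0 : 0 < m := by linarith
  have hm1 : 0 < m - 1 := by linarith
  have hβ : 0 < betaExp σ := one_div_pos.2 hσ
  have hα : 0 < alphaExp m σ := div_pos (by linarith) (mul_pos hσ hm1)
  obtain ⟨lam, W, G, hlam, h, hG, hW, s₁, hs₁, hW_pos⟩ :=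
    exists_isShot_rpow hσ.le (add_pos hα hβ) hβ ⟨inv_pos.2 hm0, inv_lt_one_of_one_lt₀ hm⟩
  set R := lam ^ σ⁻¹
  have hR : 0 < R := Real.rpow_pos_of_pos hlam _
  set c := R ^ (2 / (m - 1))
  have hc : 0 < c := Real.rpow_pos_of_pos hR _
  have hcR : c ^ m = c * R ^ 2 := by
    rw [← Real.rpow_mul hR.le, ← Real.rpow_natCast R 2, ← Real.rpow_add hR]
    congr 1
    push_cast
    field_simp
    ring
  have hpair := h.isFluxPair hm0 hc.le hR (Real.rpow_inv_rpow hlam.le hσ.ne') hcR hW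
  refine ⟨_, hpair.isGoodProfile hm0 ?_, R, hR, hpair.hasInterfaceAt hR ?_ ?_
    ⟨s₁ * R, mul_pos hs₁.1 hR, mul_le_of_le_one_left hR.le hs₁.2, fun x hx => ?_⟩⟩
  · simp [hG]
  · simp [shotProfile, div_self hR.ne', h.W_zero, Real.zero_rpow (inv_ne_zero hm0.ne')]
  · simp [div_self hR.ne', h.G_zero]
  · have hx_lt : x / R < 1 := (div_lt_one hR).2 hx.2
    have hx_gt : 1 - s₁ < x / R := by
      rw [lt_div_iff₀ hR]
      linarith [hx.1]
    rw [shotProfile, max_eq_left (sub_pos.2 hx_lt).le]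
    exact mul_pos hc (Real.rpow_pos_of_pos (hW_pos _ ⟨sub_pos.2 hx_lt, by linarith⟩) _)

end ProfileOfShot

section ExplicitProfile

theorem hasDerivAt_max_zero_rpow {q : ℝ} (hq : 1 < q) (r : ℝ) :
    HasDerivAt (fun r : ℝ => max r 0 ^ q) (q * max r 0 ^ (q - 1)) r := by
  rw [← hasDerivWithinAt_univ]
  exact hasDerivWithinAt_comp_max_zero (u := fun r => r ^ q) (u' := fun r => q * r ^ (q - 1))
    (fun _ => (Real.hasDerivAt_rpow_const (Or.inr hq.le)).hasDerivWithinAt)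
    (by rw [Real.zero_rpow (sub_pos.2 hq).ne', mul_zero])

theorem max_zero_rpow_add_one {k : ℝ} (hk : 0 < k) (r : ℝ) :
    max r 0 ^ (k + 1) = max r 0 ^ k * r := by
  rcases le_total r 0 with h | h
  · rw [max_eq_right h, Real.zero_rpow hk.ne', Real.zero_rpow (by linarith), zero_mul]
  · rw [max_eq_left h, Real.rpow_add_one' h (by linarith)]

theorem hasDerivAt_rpow_mul_max_rpow {p k S A B x : ℝ} (hp : 1 ≤ p) (hk : 0 < k) (hS : 1 ≤ S)
    (hx : 0 ≤ x) :
    HasDerivAt (fun x : ℝ => x ^ p * max (A - B * x ^ S) 0 ^ (k + 1))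
      (x ^ (p - 1) * max (A - B * x ^ S) 0 ^ k * (p * A - (p + (k + 1) * S) * B * x ^ S)) x := by
  have hbase : HasDerivAt (fun x : ℝ => A - B * x ^ S) (-(B * (S * x ^ (S - 1)))) x :=
    ((Real.hasDerivAt_rpow_const (Or.inr hS)).const_mul B).const_sub A
  have hmul_self : ∀ r : ℝ, 1 ≤ r → x ^ r = x ^ (r - 1) * x := fun r hr => by
    rw [← Real.rpow_add_one' hx (by linarith), sub_add_cancel]
  refine ((Real.hasDerivAt_rpow_const (Or.inr hp)).mul
    ((hasDerivAt_max_zero_rpow (lt_add_of_pos_left 1 hk) _).comp x hbase)).congr_deriv ?_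
  simp only [Function.comp_apply, max_zero_rpow_add_one hk, add_sub_cancel_right]
  rw [hmul_self p hp, hmul_self S hS]
  ring

variable {m x : ℝ}

theorem sigmaStar_sq (hm : 0 < m) : sigmaStar m ^ 2 = 2 * (m + 1) := Real.sq_sqrt (by linarith)

theorem one_lt_sigmaStar (hm : 0 < m) : 1 < sigmaStar m := by
  rw [sigmaStar, Real.lt_sqrt zero_le_one]
  linarith

theorem betaExp_sigmaStar (hm : 0 < m) : betaExp (sigmaStar m) = sigmaStar m / (2 * (m + 1)) := by
  have hS := one_lt_sigmaStar hm
  rw [betaExp, ← sigmaStar_sq hm]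
  field_simp

theorem alphaExp_add_betaExp_sigmaStar (hm : 1 < m) :
    alphaExp m (sigmaStar m) + betaExp (sigmaStar m) = (sigmaStar m + 2) / (2 * (m - 1)) := by
  have hS := one_lt_sigmaStar (zero_lt_one.trans hm)
  have hm1 : 0 < m - 1 := sub_pos.2 hm
  rw [alphaExp, betaExp]
  field_simp
  linear_combination -sigmaStar_sq (zero_lt_one.trans hm)

theorem constB_pos (hm : 1 < m) : 0 < constB m := by
  have hS := one_lt_sigmaStar (zero_lt_one.trans hm)
  have hm1 : 0 < m - 1 := sub_pos.2 hm
  rw [constB]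
  positivity

/-- The positive part in the definition of `fStar`, so that
`fStar m x = x ^ (2 / (m - 1)) * fStarBase m x ^ (1 / (m - 1))`. -/
noncomputable def fStarBase (m x : ℝ) : ℝ :=
  max ((m - 1) / (2 * m * (m + 1)) - constB m * x ^ sigmaStar m) 0

/-- The flux `(f ^ m)' + β x f` of the explicit profile `f = fStar m`, in closed form. -/
noncomputable def fStarFlux (m x : ℝ) : ℝ :=
  m * (sigmaStar m + 2) / (m - 1) * (x ^ (2 / (m - 1) + 1) * fStarBase m x ^ (1 / (m - 1) + 1))

theorem fStarBase_nonneg : 0 ≤ fStarBase m x := le_max_right _ _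

theorem fStar_eq : fStar m x = x ^ (2 / (m - 1)) * fStarBase m x ^ (1 / (m - 1)) := rfl

theorem fStar_rpow (hm : 1 < m) (hx : 0 ≤ x) :
    fStar m x ^ m = x ^ (2 / (m - 1) + 2) * fStarBase m x ^ (1 / (m - 1) + 1) := by
  have hm1 : m - 1 ≠ 0 := (sub_pos.2 hm).ne'
  rw [fStar_eq, Real.mul_rpow (Real.rpow_nonneg hx _) (Real.rpow_nonneg fStarBase_nonneg _),
    ← Real.rpow_mul hx, ← Real.rpow_mul fStarBase_nonneg]
  congr 2 <;> field_simp <;> ring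

theorem hasDerivWithinAt_fStar_rpow (hm : 1 < m) (hx : 0 ≤ x) :
    HasDerivWithinAt (fun x => fStar m x ^ m)
      (fStarFlux m x - betaExp (sigmaStar m) * x * fStar m x) (Ici 0) x := by
  have hm1 : 0 < m - 1 := sub_pos.2 hm
  have hk : 0 < 1 / (m - 1) := one_div_pos.2 hm1
  have h2k : 0 < 2 / (m - 1) := div_pos two_pos hm1
  have hS := one_lt_sigmaStar (zero_lt_one.trans hm)
  refine ((hasDerivAt_rpow_mul_max_rpow (by linarith) hk hS.le hx).hasDerivWithinAt.congr
    (fun y hy => fStar_rpow hm hy) (fStar_rpow hm hx)).congr_deriv ?_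
  have hpow : x ^ (2 / (m - 1) + 1) = x ^ (2 / (m - 1)) * x := Real.rpow_add_one' hx (by linarith)
  have hexp : 2 / (m - 1) + 2 - 1 = 2 / (m - 1) + 1 := by ring
  have hbase : fStarBase m x ^ (1 / (m - 1) + 1) = fStarBase m x ^ (1 / (m - 1)) *
      ((m - 1) / (2 * m * (m + 1)) - constB m * x ^ sigmaStar m) := max_zero_rpow_add_one hk _
  rw [betaExp_sigmaStar (zero_lt_one.trans hm), fStarFlux, fStar_eq, ← fStarBase, hbase, hexp, hpow]
  field_simp
  ring

theorem hasDerivWithinAt_fStarFlux (hm : 1 < m) (hx : 0 ≤ x) :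
    HasDerivWithinAt (fStarFlux m)
      ((alphaExp m (sigmaStar m) + betaExp (sigmaStar m) - x ^ sigmaStar m) * fStar m x)
      (Ici 0) x := by
  have hm1 : 0 < m - 1 := sub_pos.2 hm
  have hk : 0 < 1 / (m - 1) := one_div_pos.2 hm1
  have h2k : 0 < 2 / (m - 1) := div_pos two_pos hm1
  have hS := one_lt_sigmaStar (zero_lt_one.trans hm)
  refine ((hasDerivAt_rpow_mul_max_rpow (by linarith) hk hS.le hx).const_mul
    (m * (sigmaStar m + 2) / (m - 1))).hasDerivWithinAt.congr_deriv ?_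
  rw [alphaExp_add_betaExp_sigmaStar hm, fStar_eq, ← fStarBase, add_sub_cancel_right]
  have hB : m * (sigmaStar m + 2) / (m - 1) *
      ((2 / (m - 1) + 1 + (1 / (m - 1) + 1) * sigmaStar m) * constB m) = 1 := by
    rw [constB]
    field_simp
    ring
  have hA : m * (sigmaStar m + 2) / (m - 1) *
      ((2 / (m - 1) + 1) * ((m - 1) / (2 * m * (m + 1)))) = (sigmaStar m + 2) / (2 * (m - 1)) := by
    field_simp
    ring
  linear_combination x ^ (2 / (m - 1)) * fStarBase m x ^ (1 / (m - 1)) * (hA - x ^ sigmaStar m * hB)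

theorem isFluxPair_fStar (hm : 1 < m) : IsFluxPair m (sigmaStar m) (fStar m) (fStarFlux m) where
  nonneg _ hx := mul_nonneg (Real.rpow_nonneg hx _) (Real.rpow_nonneg fStarBase_nonneg _)
  hasDerivWithinAt_pow _ hx := hasDerivWithinAt_fStar_rpow hm hx
  hasDerivWithinAt_flux _ hx := hasDerivWithinAt_fStarFlux hm hx

theorem exists_fStarBase_eq_zero (hm : 1 < m) :
    ∃ R, 0 < R ∧ fStarBase m R = 0 ∧ ∀ x ∈ Ioo 0 R, 0 < fStarBase m x := by
  have hm1 : 0 < m - 1 := sub_pos.2 hm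
  have hB := constB_pos hm
  have hS := zero_lt_one.trans (one_lt_sigmaStar (zero_lt_one.trans hm))
  set A := (m - 1) / (2 * m * (m + 1))
  have hAB : 0 < A / constB m := by positivity
  have hR : constB m * ((A / constB m) ^ (sigmaStar m)⁻¹) ^ sigmaStar m = A := by
    rw [Real.rpow_inv_rpow hAB.le hS.ne', mul_div_cancel₀ A hB.ne']
  refine ⟨(A / constB m) ^ (sigmaStar m)⁻¹, Real.rpow_pos_of_pos hAB _, ?_, fun x hx => ?_⟩
  · rw [fStarBase, hR, sub_self, max_self]
  · refine lt_max_of_lt_left (sub_pos.2 ?_)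
    calc constB m * x ^ sigmaStar m
        < constB m * ((A / constB m) ^ (sigmaStar m)⁻¹) ^ sigmaStar m :=
          mul_lt_mul_of_pos_left (Real.rpow_lt_rpow hx.1.le hx.2 hS) hB
      _ = A := hR

theorem fStar_isGoodProfileWithInterface (hm : 1 < m) :
    IsGoodProfileWithInterface m (sigmaStar m) (fStar m) ∧ SatisfiesP2 m (fStar m) := by
  have hm1 : 0 < m - 1 := sub_pos.2 hm
  have hk : 0 < 1 / (m - 1) := one_div_pos.2 hm1
  have h2k : 0 < 2 / (m - 1) := div_pos two_pos hm1
  have hpair := isFluxPair_fStar hm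
  have hf_zero : fStar m 0 = 0 := by rw [fStar_eq, Real.zero_rpow h2k.ne', zero_mul]
  have hF_zero : fStarFlux m 0 = 0 := by
    rw [fStarFlux, Real.zero_rpow (by positivity), zero_mul, mul_zero]
  obtain ⟨R, hR, hbase_R, hbase_pos⟩ := exists_fStarBase_eq_zero hm
  have hf_R : fStar m R = 0 := by rw [fStar_eq, hbase_R, Real.zero_rpow hk.ne', mul_zero]
  have hF_R : fStarFlux m R = 0 := by
    rw [fStarFlux, hbase_R, Real.zero_rpow (by positivity), mul_zero, mul_zero]
  have hpos : ∀ x ∈ Ioo (R - R) R, 0 < fStar m x := fun x hx => by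
    rw [sub_self] at hx
    exact mul_pos (Real.rpow_pos_of_pos hx.1 _) (Real.rpow_pos_of_pos (hbase_pos x hx) _)
  exact ⟨⟨hpair.isGoodProfile (by linarith) hF_zero, R, hR,
    hpair.hasInterfaceAt hR hf_R hF_R ⟨R, hR, le_rfl, hpos⟩⟩, hpair.satisfiesP2 hF_zero hf_zero⟩

end ExplicitProfile

theorem theorem1p1 (m : ℝ) (hm : 1 < m) :
    (∀ σ : ℝ, 0 < σ → ∃ f : ℝ → ℝ, IsGoodProfileWithInterface m σ f) ∧
    (IsGoodProfileWithInterface m (sigmaStar m) (fStar m) ∧ SatisfiesP2 m (fStar m)) :=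
  ⟨fun _ hσ => exists_isGoodProfileWithInterface hm hσ, fStar_isGoodProfileWithInterface hm⟩
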